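/- Let $G$ be a countably infinite discrete group and let $2^G=\{0,1\}^G$ carry the product topology and the left shift action $(g\cdot w)(h)=w(g^{-1}h)$. Let $\mathrm{Free}(2^G)=\{w\in 2^G : g\cdot w\neq w \text{ for all } g\in G\setminus\{1_G\}\}$, and write $\overline{W}$ for the closure of $W\subseteq 2^G$. Let $G$ act freely and in a Borel way on a standard Borel space $X$ (free means that $g\cdot x\ne x$ for all $x\in X$ and $g\neq 1_G$). A set $M\subseteq X$ is called syndetic if $X=F\cdot M$ for some finite $F\subseteq G$. For Borel $A\subseteq X$ let $f_A:X\to 2^G$ be the map $f_A(x)(g)=1_{g\cdot A}(x)$. For a Borel probability measure $\mu$ on $X$ let $\mathrm{MALG}_\mu$ be the space of classes $[A]_\mu$ of Borel sets $A\subseteq X$ modulo $\mu$-null sets, with the metric $d([A]_\mu,[B]_\mu)=\mu(A\,\triangle\, B)$. Then there exists a $G$-equivariant Borel map $f:X\to 2^G$ with $\overline{f(X)}\subseteq \mathrm{Free}(2^G)$. Furthermore: (1) Suppose that $Y\subseteq X$ is a Borel set such that $X\setminus Y$ is syndetic, and that $\phi:Y\to\{0,1\}$ is a Borel function. Then there exists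 a $G$-equivariant Borel map $f:X\to 2^G$ with $\overline{f(X)}\subseteq\mathrm{Free}(2^G)$ and $f(y)(1_G)=\phi(y)$ for all $y\in Y$. (2) Let $Y$ and $\phi$ be as in part (1). Then there exists a family $\{f_w\}_{w\in 2^{\mathbb N}}$ of maps, each satisfying the conclusion of part (1), such that $\overline{f_w(X)}\cap\overline{f_z(X)}=\emptyset$ for all distinct $w,z\in 2^{\mathbb N}$. In addition, the map $(w,x)\mapsto f_w(x)$ from $2^{\mathbb N}\times X$ to $2^G$ is Borel, and for each fixed $x\in X$ the map $w\mapsto f_w(x)$ is continuous. (3) For any $G$-quasi-invariant Borel probability measure $\mu$ on $X$ (that is, $\mu(g\cdot A)=0$ if and only if $\mu(A)=0$, for all $g\in G$ and Borel $A\subseteq X$), the set $$\{[A]_\mu : A\subseteq X \text{ is Borel and } f_A(X)\subseteq\mathrm{Free}(2^G)\}$$ is a dense $G_\delta$ subset of $\mathrm{MALG}_\mu$. -/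

import Mathlib

open MeasureTheory
open scoped Pointwise

namespace TwoShift

/-- The left shift action of `G` on `2^G`, with `2 = Bool`: `(g · w)(h) = w (g⁻¹ h)`. -/
def shift {G : Type*} [Group G] (g : G) (w : G → Bool) : G → Bool :=
  fun h => w (g⁻¹ * h)

/-- The free part `Free(2^G)`: the points of `2^G` with trivial stabilizer. -/
def freePart (G : Type*) [Group G] : Set (G → Bool) :=
  {w | ∀ g : G, g ≠ 1 → shift g w ≠ w}

/-- A map `f : X → 2^G` is `G`-equivariant. -/
def Equivariant {G X : Type*} [Group G] [MulAction G X] (f : X → G → Bool) : Prop :=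
  ∀ (g : G) (x : X), f (g • x) = shift g (f x)

/-- `f : X → 2^G` is a `G`-equivariant Borel map whose image has closure inside `Free(2^G)`.
The space `G → Bool` carries the product topology and the product `σ`-algebra, which is its
Borel `σ`-algebra when `G` is countable. -/
structure IsMapIntoFree {G X : Type*} [Group G] [MulAction G X] [MeasurableSpace X]
    (f : X → G → Bool) : Prop where
  measurable : Measurable f
  equivariant : Equivariant f
  closure_subset : closure (Set.range f) ⊆ freePart G

/-- `M ⊆ X` is syndetic: `X = F · M` for some finite `F ⊆ G`. -/
def IsSyndetic (G : Type*) {X : Type*} [Group G] [MulAction G X] (M : Set X) : Prop :=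
  ∃ F : Finset G, (F : Set G) • M = Set.univ

open Classical in
/-- The map `f_A : X → 2^G`, `f_A(x)(g) = 1_{g · A}(x)`, attached to `A ⊆ X`. -/
noncomputable def setMap (G : Type*) {X : Type*} [Group G] [MulAction G X] (A : Set X) :
    X → G → Bool :=
  fun x g => decide (x ∈ g • A)

/-- `μ` is `G`-quasi-invariant: every `g ∈ G` maps the measure class of `μ` to itself. (Absolute
continuity of the image measure is demanded for `g` and for `g⁻¹`, so the classes are equal.) -/
def IsQuasiInvariant (G : Type*) {X : Type*} [Group G] [MulAction G X] [MeasurableSpace X]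
    (μ : Measure X) : Prop :=
  ∀ g : G, Measure.QuasiMeasurePreserving (fun x : X => g • x) μ μ

/-- The measure algebra `MALG_μ`: measurable sets with the pseudometric `μ (A ∆ B)`, where sets at
distance zero are identified, with the resulting metric topology. -/
abbrev MALG {X : Type*} [MeasurableSpace X] (μ : Measure X) : Type _ :=
  SeparationQuotient (MeasuredSets μ)

/-- A measurable set as a point of Mathlib's pseudometric space of measurable sets. -/
def measuredSet {X : Type*} [MeasurableSpace X] (μ : Measure X) (A : Set X)
    (hA : MeasurableSet A) : MeasuredSets μ :=
  ⟨A, hA⟩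

/-- The class `[A]_μ` of a measurable set in `MALG_μ`. -/
noncomputable def MALG.mk {X : Type*} [MeasurableSpace X] (μ : Measure X) (A : Set X) (hA : MeasurableSet A) :
    MALG μ :=
  SeparationQuotient.mk (measuredSet μ A hA)

/-- The set of classes `[A]_μ` of Borel sets `A ⊆ X` with `f_A(X) ⊆ Free(2^G)`. -/
def freeClasses (G : Type*) {X : Type*} [Group G] [MulAction G X] [MeasurableSpace X]
    (μ : Measure X) : Set (MALG μ) :=
  {a | ∃ (A : Set X) (hA : MeasurableSet A),
    Set.range (setMap G A) ⊆ freePart G ∧ a = MALG.mk μ A hA}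

end TwoShift

/-! An equivariant map into `2^G` has the form `x ↦ (g ↦ ψ (g⁻¹ • x))` for a single `ψ : X → Bool`.
By compactness-style reasoning with clopen sets, the closure of its image is free as soon as each `g
≠ 1` has a finite window `T` such that, for every `x`, some `t ∈ T` gives `ψ (t • x) ≠ ψ (t • g •
x)`.

Such a `ψ` is built in stages, one `g` per stage. Each stage starts with a syndetic Borel set of
undetermined positions (at the outset the complement of `Y`), fixes values on part of it, and leaves
a smaller syndetic set undetermined; the goal of the stage then holds whatever is put there later.
The stage also records one bit of `w`, which a clopen set reads off at every point, so distinct `w`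
give disjoint closures. The undetermined sets, windows and clopen sets do not depend on `w`, whence
continuity in `w`.

The core is `exists_aperiodic_step`. Sparse Borel markers carry disjoint blocks with many free
positions. A constraint fails for a proportion at most `2 ^ (-k)` of the assignments of any block it
meets, while only polynomially many (in `k`) constraints meet a block. Hence a greedy procedure
suffices (`exists_measurable_greedy`): blocks are treated by Borel colour classes, and the last
block meeting a constraint secures it. In `exists_coding_step` the bit is carried by parities of
disjoint windows.

For the measure algebra, density follows by altering the indicator of `A` only on a syndetic set of
small measure. Freeness modulo null sets is a countable intersection of open conditions, and the
invariant null set of bad points is repaired with a map already constructed. -/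

namespace TwoShift

/-! ### Counting and finite subsets of groups -/

section Combinatorics

/-- A set of families that is determined by finitely many coordinates is clopen. -/
lemma isClopen_of_finite_dep {ι : Type*} (N : Finset ι) (S : Set (ι → Bool))
    (h : ∀ u u' : ι → Bool, (∀ g ∈ N, u g = u' g) → (u ∈ S ↔ u' ∈ S)) : IsClopen S := by
  have key : ∀ S : Set (ι → Bool),
      (∀ u u' : ι → Bool, (∀ g ∈ N, u g = u' g) → (u ∈ S ↔ u' ∈ S)) → IsOpen S := by
    intro S h
    rw [isOpen_pi_iff]
    intro u hu
    refine ⟨N, fun g => {u g}, fun g _ => ⟨isOpen_discrete _, rfl⟩, fun u' hu' => ?_⟩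
    refine (h u u' fun g hg => ?_).1 hu
    exact (hu' g hg).symm
  refine ⟨⟨key _ fun u u' huu' => not_congr (h u u' huu')⟩, key S h⟩

/-- A family of subsets of `W` in which every member is determined by its trace off `C`
has density at most `2 ^ (-#C)`. -/
lemma card_mul_two_pow_le {G : Type*} [DecidableEq G] {W C : Finset G} (hC : C ⊆ W)
    {V : Finset (Finset G)} (hV : V ⊆ W.powerset)
    (h : ∀ v ∈ V, ∀ v' ∈ V, v \ C = v' \ C → v = v') :
    V.card * 2 ^ C.card ≤ 2 ^ W.card := by
  have h1 : V.card ≤ (W \ C).powerset.card := by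
    refine Finset.card_le_card_of_injOn (fun v => v \ C) ?_ ?_
    · intro v hv
      have := Finset.mem_powerset.1 (hV hv)
      exact Finset.mem_coe.2 (Finset.mem_powerset.2 (Finset.sdiff_subset_sdiff this le_rfl))
    · intro v hv v' hv' hvv'
      exact h v hv v' hv' hvv'
  rw [Finset.card_powerset] at h1
  calc V.card * 2 ^ C.card ≤ 2 ^ (W \ C).card * 2 ^ C.card := Nat.mul_le_mul_right _ h1
    _ = 2 ^ W.card := by rw [← pow_add, Finset.card_sdiff_add_card_eq_card hC]

/-- Right translation by a nontrivial element has an independent set of proportion `1/3` inside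
every finite set. -/
lemma exists_independent_subset {G : Type*} [Group G] [DecidableEq G] {s : G} (hs : s ≠ 1)
    (C : Finset G) :
    ∃ C' ⊆ C, C.card ≤ 3 * C'.card ∧ ∀ r ∈ C', r * s ∉ C' := by
  -- A maximal independent `C'` suffices: by maximality `C` is covered by `C'`, `C' * s` and `C' *
  -- s⁻¹`.
  obtain ⟨C', hC'⟩ := (C.powerset.filter fun C' => ∀ r ∈ C', r * s ∉ C').exists_maximal
    ⟨∅, by simp⟩
  have hmem := hC'.prop
  simp only [Finset.mem_filter, Finset.mem_powerset] at hmem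
  refine ⟨C', hmem.1, ?_, hmem.2⟩
  have hsub : C ⊆ C' ∪ (C'.image (· * s) ∪ C'.image (· * s⁻¹)) := by
    intro r hr
    by_contra hcon
    simp only [Finset.mem_union, Finset.mem_image, not_or, not_exists, not_and] at hcon
    obtain ⟨h1, h2, h3⟩ := hcon
    have hins : insert r C' ∈ C.powerset.filter fun C' => ∀ r ∈ C', r * s ∉ C' := by
      simp only [Finset.mem_filter, Finset.mem_powerset, Finset.mem_insert]
      refine ⟨Finset.insert_subset hr hmem.1, ?_⟩
      rintro x (rfl | hx) (h | h)
      · exact hs (by simpa using h)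
      · exact h3 _ h (by simp)
      · exact h2 _ hx h
      · exact hmem.2 x hx h
    exact h1 (hC'.le_of_ge hins (Finset.subset_insert _ _) (Finset.mem_insert_self _ _))
  calc C.card ≤ _ := Finset.card_le_card hsub
    _ ≤ C'.card + (C'.card + C'.card) := by
      refine (Finset.card_union_le _ _).trans (Nat.add_le_add le_rfl ?_)
      exact (Finset.card_union_le _ _).trans
        (Nat.add_le_add Finset.card_image_le Finset.card_image_le)
    _ = 3 * C'.card := by ring

/-- In an infinite group there are arbitrarily many pairwise disjoint right translates of a
finite set. -/
lemma exists_separated {G : Type*} [Group G] [Infinite G] (F : Finset G) (K : ℕ) :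
    ∃ I : Finset G, I.card = K ∧
      ∀ a ∈ I, ∀ a' ∈ I, ∀ f ∈ F, ∀ f' ∈ F, f * a = f' * a' → a = a' := by
  classical
  induction K with
  | zero => exact ⟨∅, rfl, by simp⟩
  | succ K ih =>
    obtain ⟨I, hI, hsep⟩ := ih
    obtain ⟨b, hb⟩ := Infinite.exists_notMem_finset (I ∪ F⁻¹ * F * I)
    simp only [Finset.mem_union, not_or] at hb
    have hb' : ∀ a ∈ I, ∀ f ∈ F, ∀ f' ∈ F, f * b ≠ f' * a := by
      intro a ha f hf f' hf' h
      apply hb.2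
      have : b = f⁻¹ * f' * a := by rw [mul_assoc, ← h]; group
      rw [this]
      exact Finset.mul_mem_mul (Finset.mul_mem_mul (Finset.inv_mem_inv hf) hf') ha
    refine ⟨insert b I, by rw [Finset.card_insert_of_notMem hb.1, hI], ?_⟩
    simp only [Finset.mem_insert]
    rintro a (rfl | ha) a' (rfl | ha') f hf f' hf' h
    · rfl
    · exact absurd h (hb' a' ha' f hf f' hf')
    · exact absurd h.symm (hb' a ha f' hf' f hf)
    · exact hsep a ha a' ha' f hf f' hf' h

/-- Exponentials dominate polynomials. -/
lemma exists_poly_lt_two_pow (C a b d : ℕ) : ∃ k : ℕ, 1 ≤ k ∧ C * (a * k + b) ^ d < 2 ^ k := by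
  have h := tendsto_pow_const_div_const_pow_of_one_lt d (one_lt_two : (1 : ℝ) < 2)
  have h2 := (h.const_mul ((C : ℝ) * (a + b) ^ d)).eventually_lt_const
    (show (C : ℝ) * (a + b) ^ d * 0 < 1 by simp)
  obtain ⟨k, hk, hk1⟩ := (h2.and (Filter.eventually_ge_atTop 1)).exists
  refine ⟨k, hk1, ?_⟩
  rw [← mul_div_assoc, div_lt_one (by positivity), mul_assoc, ← mul_pow] at hk
  have h3 : C * ((a + b) * k) ^ d < 2 ^ k := by exact_mod_cast hk
  refine lt_of_le_of_lt (Nat.mul_le_mul_left _ (Nat.pow_le_pow_left ?_ _)) h3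
  nlinarith [Nat.mul_le_mul_left b hk1]

end Combinatorics

/-! ### Borel markers for free actions -/

section Markers

variable {G : Type*} [Group G] {X : Type*} [MeasurableSpace X] [StandardBorelSpace X]
  [MulAction G X] [MeasurableConstSMul G X]

/-- For a free Borel action and a finite `D`, the space is covered by countably many Borel sets
`A n` with `A n ∩ d⁻¹ • A n = ∅` for all `d ∈ D \ {1}`. -/
lemma exists_measurable_cover (hfree : ∀ (g : G) (x : X), g • x = x → g = 1) (D : Finset G) :
    ∃ A : ℕ → Set X, (∀ n, MeasurableSet (A n)) ∧ (∀ x, ∃ n, x ∈ A n) ∧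
      ∀ n, ∀ x ∈ A n, ∀ d ∈ D, d • x ∈ A n → d = 1 := by
  classical
  obtain ⟨S, hS, hsep⟩ := exists_seq_separating X (MeasurableSet.empty) Set.univ
  -- `B c` prescribes the trace of a point on finitely many members of a countable separating
  -- family. Finitely many members already separate `x` from all `d • x` with `d ∈ D \ {1}`.
  let B : Finset ℕ × Finset ℕ → Set X := fun c => {x | ∀ i ∈ c.1, x ∈ S i ↔ i ∈ c.2}
  have hB : ∀ c, MeasurableSet (B c) := by
    intro c
    have : B c = ⋂ i ∈ c.1, {x | x ∈ S i ↔ i ∈ c.2} := by ext; simp [B]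
    rw [this]
    refine Finset.measurableSet_biInter _ fun i _ => ?_
    by_cases h : i ∈ c.2
    · simpa [h] using hS i
    · simp only [h, iff_false]
      exact (hS i).compl
  obtain ⟨e, he⟩ := exists_surjective_nat (Finset ℕ × Finset ℕ)
  refine ⟨fun n => {x | x ∈ B (e n) ∧ ∀ d ∈ D, d ≠ 1 → d • x ∉ B (e n)}, fun n => ?_, fun x => ?_,
    fun n x hx d hd hdx => ?_⟩
  · have : {x | x ∈ B (e n) ∧ ∀ d ∈ D, d ≠ 1 → d • x ∉ B (e n)} =
        B (e n) ∩ ⋂ d ∈ D.filter (· ≠ 1), ((d • ·) ⁻¹' B (e n))ᶜ := by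
      ext; simp
    change MeasurableSet {x | x ∈ B (e n) ∧ ∀ d ∈ D, d ≠ 1 → d • x ∉ B (e n)}
    rw [this]
    exact (hB _).inter (Finset.measurableSet_biInter _ fun d _ =>
      ((measurable_const_smul d) (hB _)).compl)
  · have h : ∀ d : G, ∃ i, d ≠ 1 → ¬ (x ∈ S i ↔ d • x ∈ S i) := by
      intro d
      by_contra! hcon
      have h1 := hcon 0
      exact h1.1 (hfree d x (hsep x trivial (d • x) trivial fun i => (hcon i).2).symm)
    choose i hi using h
    obtain ⟨n, hn⟩ := he (D.image i, (D.image i).filter fun j => x ∈ S j)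
    refine ⟨n, ?_, fun d hd hd1 => ?_⟩
    · rw [hn]
      intro j hj
      simp only [Finset.mem_filter]
      exact ⟨fun h => ⟨hj, h⟩, fun h => h.2⟩
    · rw [hn]
      intro hmem
      have hj : i d ∈ D.image i := Finset.mem_image_of_mem _ hd
      have h1 := hmem (i d) hj
      simp only [Finset.mem_filter] at h1
      exact hi d hd1 ⟨fun h => h1.2 ⟨hj, h⟩, fun h => (h1.1 h).2⟩
  · by_contra h1
    exact hx.2 d hd h1 hdx.1

/-- Borel maximal discrete sets: every Borel set `Z` has a Borel `D`-discrete subset `M` whose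
`D`-saturation covers `Z`. -/
lemma exists_maximal_discrete (hfree : ∀ (g : G) (x : X), g • x = x → g = 1) (D : Finset G)
    (h1 : 1 ∈ D) (hinv : ∀ d ∈ D, d⁻¹ ∈ D) {Z : Set X} (hZ : MeasurableSet Z) :
    ∃ M ⊆ Z, MeasurableSet M ∧ (∀ x ∈ M, ∀ d ∈ D, d • x ∈ M → d = 1) ∧
      ∀ z ∈ Z, ∃ d ∈ D, d • z ∈ M := by
  classical
  obtain ⟨A, hA, hcov, hdisc⟩ := exists_measurable_cover hfree D
  -- Stage `n` adds the points of `Z ∩ A n` with no `D`-translate chosen so far; points added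
  -- together do not conflict because `A n` is itself `D`-discrete.
  let N : ℕ → Set X := fun n =>
    Nat.rec ∅ (fun n I => I ∪ {x | x ∈ Z ∧ x ∈ A n ∧ ∀ d ∈ D, d • x ∉ I}) n
  have hN : ∀ n, N (n + 1) = N n ∪ {x | x ∈ Z ∧ x ∈ A n ∧ ∀ d ∈ D, d • x ∉ N n} := fun n => rfl
  have hmeas : ∀ n, MeasurableSet (N n) := by
    intro n
    induction n with
    | zero => exact MeasurableSet.empty
    | succ n ih =>
      rw [hN]
      refine ih.union ?_
      have : {x | x ∈ Z ∧ x ∈ A n ∧ ∀ d ∈ D, d • x ∉ N n} =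
          Z ∩ (A n ∩ ⋂ d ∈ D, ((d • ·) ⁻¹' N n)ᶜ) := by
        ext; simp only [Set.mem_ofPred_eq, Set.mem_inter_iff, Set.mem_iInter, Set.mem_compl_iff,
          Set.mem_preimage]
      rw [this]
      exact hZ.inter ((hA n).inter (Finset.measurableSet_biInter _ fun d _ =>
        ((measurable_const_smul d) ih).compl))
  have hmono : Monotone N := monotone_nat_of_le_succ fun n => Set.subset_union_left
  have hsub : ∀ n, N n ⊆ Z := by
    intro n
    induction n with
    | zero => exact Set.empty_subset _
    | succ n ih => exact Set.union_subset ih fun x hx => hx.1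
  have hd : ∀ n, ∀ x ∈ N n, ∀ d ∈ D, d • x ∈ N n → d = 1 := by
    intro n
    induction n with
    | zero => intro x hx; exact hx.elim
    | succ n ih =>
      rw [hN]
      rintro x (hx | hx) d hd (hdx | hdx)
      · exact ih x hx d hd hdx
      · exact absurd (by simpa using hx) (hdx.2.2 d⁻¹ (hinv d hd))
      · exact absurd hdx (hx.2.2 d hd)
      · exact hdisc n x hx.2.1 d hd hdx.2.1
  refine ⟨⋃ n, N n, Set.iUnion_subset hsub, MeasurableSet.iUnion hmeas, ?_, ?_⟩
  · intro x hx d hdD hdx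
    obtain ⟨n, hn⟩ := Set.mem_iUnion.1 hx
    obtain ⟨m, hm⟩ := Set.mem_iUnion.1 hdx
    exact hd (max n m) x (hmono (le_max_left _ _) hn) d hdD (hmono (le_max_right _ _) hm)
  · intro z hz
    obtain ⟨n, hn⟩ := hcov z
    rcases em (∃ d ∈ D, d • z ∈ N n) with ⟨d, hd, hdz⟩ | h
    · exact ⟨d, hd, Set.mem_iUnion.2 ⟨n, hdz⟩⟩
    · push Not at h
      refine ⟨1, h1, Set.mem_iUnion.2 ⟨n + 1, ?_⟩⟩
      rw [one_smul]
      exact Or.inr ⟨hz, hn, h⟩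

end Markers

/-! ### Borel choice of values on disjoint blocks -/

section Assignment

open Classical in
/-- The pattern of `ψ` at `m` after overwriting the free positions (those in `U`) of the window `W`
by the indicator function of `v`. -/
noncomputable def patch {G X : Type*} [Group G] [MulAction G X] (ψ : X → Bool) (U : Set X)
    (W v : Finset G) (m : X) : G → Bool :=
  fun g => if g ∈ W ∧ g • m ∈ U then decide (g ∈ v) else ψ (g • m)

lemma patch_of_mem {G X : Type*} [Group G] [MulAction G X] {ψ : X → Bool} {U : Set X}
    {W v : Finset G} {m : X} {g : G} (hg : g ∈ W) (hgm : g • m ∈ U) :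
    (patch ψ U W v m g = true ↔ g ∈ v) := by
  simp [patch, hg, hgm]

lemma patch_of_not {G X : Type*} [Group G] [MulAction G X] {ψ : X → Bool} {U : Set X}
    {W v : Finset G} {m : X} {g : G} (h : g ∈ W → g • m ∉ U) :
    patch ψ U W v m g = ψ (g • m) := by
  rw [patch, if_neg]
  rintro ⟨h1, h2⟩
  exact h h1 h2

variable {G : Type*} [Group G] {X : Type*} [MeasurableSpace X]
  [MulAction G X] [MeasurableConstSMul G X]

lemma measurable_patch {ψ : X → Bool} (hψ : Measurable ψ) {U : Set X} (hU : MeasurableSet U)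
    (W v : Finset G) : Measurable (fun m => patch ψ U W v m) := by
  classical
  refine measurable_pi_lambda _ fun g => ?_
  have hg : MeasurableSet {m : X | g • m ∈ U} := (measurable_const_smul g) hU
  refine Measurable.ite (p := fun m => g ∈ W ∧ g • m ∈ U) ?_ measurable_const
    (hψ.comp (measurable_const_smul g))
  by_cases h : g ∈ W
  · simpa only [h, true_and] using hg
  · simp only [h, false_and]
    exact MeasurableSet.empty

/-- Borel choice of values on disjoint blocks: if each marker `m ∈ M` has an admissible assignment
for its block `W • m`, then `ψ` can be modified on the free positions of all the blocks
so that each block carries an admissible assignment. -/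
lemma exists_measurable_assignment [Countable G] (hfree : ∀ (g : G) (x : X), g • x = x → g = 1)
    {M U : Set X} (hM : MeasurableSet M) (hU : MeasurableSet U) {ψ : X → Bool} (hψ : Measurable ψ)
    (W : Finset G) (hdisj : ∀ m ∈ M, ∀ m' ∈ M, ∀ w ∈ W, ∀ w' ∈ W, w • m = w' • m' → m = m')
    (P : X → Finset G → Prop) (hP : ∀ v, MeasurableSet {x | P x v}) (hex : ∀ m ∈ M, ∃ v, P m v) :
    ∃ ψ' : X → Bool, Measurable ψ' ∧
      (∀ y, (∀ m ∈ M, ∀ w ∈ W, w • m = y → y ∉ U) → ψ' y = ψ y) ∧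
      ∀ m ∈ M, ∃ v, P m v ∧ ∀ w ∈ W, w • m ∈ U → (ψ' (w • m) = true ↔ w ∈ v) := by
  classical
  obtain ⟨e, he⟩ := exists_surjective_nat (Finset G)
  have h : ∀ x, ∃ n, x ∉ M ∨ P x (e n) := by
    intro x
    by_cases hx : x ∈ M
    · obtain ⟨v, hv⟩ := hex x hx
      obtain ⟨n, rfl⟩ := he v
      exact ⟨n, Or.inr hv⟩
    · exact ⟨0, Or.inl hx⟩
  -- Taking the first admissible assignment in a fixed enumeration keeps the choice Borel.
  let sel : X → Finset G := fun x => e (Nat.find (h x))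
  have hsel : ∀ m ∈ M, P m (sel m) := fun m hm =>
    (Nat.find_spec (h m)).resolve_left (not_not.2 hm)
  have hmeas : ∀ w : G, Measurable (fun x => decide (w ∈ sel x)) := by
    intro w
    exact Measurable.find (f := fun n _ => decide (w ∈ e n))
      (p := fun n x => x ∉ M ∨ P x (e n)) (fun n => measurable_const)
      (fun n => hM.compl.union (hP (e n))) h
  let Q : Set X := {y | y ∈ U ∧ ∃ w ∈ W, w⁻¹ • y ∈ M}
  have hQ : MeasurableSet Q := by
    have : Q = U ∩ ⋃ w ∈ W, (w⁻¹ • ·) ⁻¹' M := by ext; simp [Q]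
    rw [this]
    exact hU.inter (Finset.measurableSet_biUnion _ fun w _ => (measurable_const_smul _) hM)
  let R : Set X := {y | ∃ w ∈ W, w⁻¹ • y ∈ M ∧ w ∈ sel (w⁻¹ • y)}
  have hR : MeasurableSet R := by
    have : R = ⋃ w ∈ W, (w⁻¹ • ·) ⁻¹' (M ∩ {x | decide (w ∈ sel x) = true}) := by
      ext
      simp only [R, Set.mem_ofPred_eq, Set.mem_iUnion, Set.mem_preimage, Set.mem_inter_iff,
        decide_eq_true_eq, exists_prop]
    rw [this]
    exact Finset.measurableSet_biUnion _ fun w _ => (measurable_const_smul _)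
      (hM.inter ((hmeas w) (measurableSet_singleton true)))
  refine ⟨fun y => if y ∈ Q then decide (y ∈ R) else ψ y, ?_, ?_, ?_⟩
  · refine Measurable.ite hQ ?_ hψ
    refine measurable_to_bool ?_
    convert hR using 1
    ext; simp
  · intro y hy
    refine if_neg ?_
    rintro ⟨hyU, w, hw, hwy⟩
    exact hy _ hwy w hw (by simp) hyU
  · intro m hm
    refine ⟨sel m, hsel m hm, fun w hw hwU => ?_⟩
    have hq : w • m ∈ Q := ⟨hwU, w, hw, by simpa using hm⟩
    simp only [hq, if_true, decide_eq_true_eq]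
    constructor
    · rintro ⟨w', hw', h1, h2⟩
      have h3 : w'⁻¹ • w • m = m := (hdisj m hm _ h1 w hw w' hw' (by simp)).symm
      have h4 : w'⁻¹ * w = 1 := hfree _ m (by rw [mul_smul, h3])
      have h5 : w' = w := by rw [inv_mul_eq_one] at h4; exact h4
      rwa [h3, h5] at h2
    · intro h
      exact ⟨w, hw, by simpa using hm, by simpa using h⟩

end Assignment

/-! ### Greedy satisfaction of local constraints -/

section Greedy

variable {G : Type*} [Group G] [Countable G] {X : Type*} [MeasurableSpace X]
  [StandardBorelSpace X] [MulAction G X] [MeasurableConstSMul G X]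

open Classical in
/-- A Borel greedy form of the local lemma. The constraints are indexed by pairs `(j, x)`;
`Bad j x u` says that the pattern `u` at `x` violates `(j, x)`, and depends only on the coordinates
`dep j x` of `u`. If every block that meets a constraint can satisfy it with overwhelming
probability, whatever the rest of the configuration is, then some Borel modification of `φ` on the
free positions of the blocks satisfies all constraints met by blocks. -/
lemma exists_measurable_greedy (hfree : ∀ (g : G) (x : X), g • x = x → g = 1)
    {M U : Set X} (hM : MeasurableSet M) (hU : MeasurableSet U) {φ : X → Bool} (hφ : Measurable φ)
    (W N : Finset G)
    (hdisj : ∀ m ∈ M, ∀ m' ∈ M, ∀ w ∈ W, ∀ w' ∈ W, w • m = w' • m' → m = m')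
    {ι : Type*} (J : Finset ι) (Bad : ι → X → (G → Bool) → Prop) (dep : ι → X → Set G)
    (hdepN : ∀ j ∈ J, ∀ x, dep j x ⊆ N)
    (hdep : ∀ j x u u', (∀ g ∈ dep j x, u g = u' g) → Bad j x u → Bad j x u')
    (hBad : ∀ j ∈ J, MeasurableSet {p : X × (G → Bool) | Bad j p.1 p.2})
    (hdepm : ∀ j ∈ J, ∀ g, MeasurableSet {x | g ∈ dep j x})
    (k : ℕ) (hk : J.card * (N⁻¹ * W).card < 2 ^ k)
    (hcount : ∀ j ∈ J, ∀ m ∈ M, ∀ h : G, (∃ g ∈ dep j (h • m), g * h ∈ W ∧ (g * h) • m ∈ U) →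
      ∀ ψ : X → Bool,
      (W.powerset.filter fun v => Bad j (h • m) fun g => patch ψ U W v m (g * h)).card * 2 ^ k
        ≤ 2 ^ W.card) :
    ∃ φ' : X → Bool, Measurable φ' ∧ (∀ y ∉ U, φ' y = φ y) ∧
      ∀ j ∈ J, ∀ x, (∃ g ∈ dep j x, ∃ m ∈ M, ∃ w ∈ W, g • x = w • m ∧ g • x ∈ U) →
        ¬ Bad j x fun g => φ' (g • x) := by
  -- Two markers whose blocks meet the same constraint differ by an element of `D`. Within a
  -- `D`-discrete colour class no constraint meets two blocks, so the whole class can be treated at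
  -- once.
  set D : Finset G := W⁻¹ * N * N⁻¹ * W with hD
  obtain ⟨A, hA, hcov, hdisc⟩ := exists_measurable_cover hfree D
  let Mi : ℕ → Set X := fun i => M ∩ disjointed A i
  have hMi : ∀ i, MeasurableSet (Mi i) := fun i => hM.inter (MeasurableSet.disjointed hA i)
  have hMiM : ∀ i, Mi i ⊆ M := fun i => Set.inter_subset_left
  have hMidisc : ∀ i, ∀ m ∈ Mi i, ∀ d ∈ D, d • m ∈ Mi i → d = 1 := fun i m hm d hd hdm =>
    hdisc i m (disjointed_subset A i hm.2) d hd (disjointed_subset A i hdm.2)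
  have hMicov : ∀ m ∈ M, ∃ i, m ∈ Mi i := by
    intro m hm
    have : m ∈ ⋃ n, disjointed A n := by
      rw [iUnion_disjointed]; exact Set.mem_iUnion.2 (hcov m)
    obtain ⟨i, hi⟩ := Set.mem_iUnion.1 this
    exact ⟨i, hm, hi⟩
  have hstep : ∀ i, ∀ ψ : X → Bool, Measurable ψ → ∃ ψ' : X → Bool, Measurable ψ' ∧
      (∀ y, (∀ m ∈ Mi i, ∀ w ∈ W, w • m = y → y ∉ U) → ψ' y = ψ y) ∧
      ∀ j ∈ J, ∀ x, (∃ g ∈ dep j x, ∃ m ∈ Mi i, ∃ w ∈ W, g • x = w • m ∧ g • x ∈ U) →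
        ¬ Bad j x fun g => ψ' (g • x) := by
    intro i ψ hψ
    -- Admissibility of `v` at `m`: every constraint met by the block is satisfied when all other
    -- values are those of `ψ`. If `g • x = w • m` then `x = (g⁻¹ * w) • m`, so `h` only ranges over
    -- `N⁻¹ * W`.
    let P : X → Finset G → Prop := fun m v => ∀ j ∈ J, ∀ h ∈ N⁻¹ * W,
      (∃ g ∈ N, g ∈ dep j (h • m) ∧ g * h ∈ W ∧ (g * h) • m ∈ U) →
        ¬ Bad j (h • m) fun g => patch ψ U W v m (g * h)
    have hP : ∀ v, MeasurableSet {x | P x v} := by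
      intro v
      have : {x | P x v} = ⋂ j ∈ J, ⋂ h ∈ N⁻¹ * W,
          ((⋃ g ∈ N, ({x : X | h • x ∈ {x | g ∈ dep j x}} ∩ {x : X | g * h ∈ W ∧ (g * h) • x ∈ U}))ᶜ ∪
          ((fun x => (h • x, fun g => patch ψ U W v x (g * h))) ⁻¹'
            {p : X × (G → Bool) | Bad j p.1 p.2})ᶜ) := by
        ext x
        simp only [P, Set.mem_ofPred_eq, Set.mem_iInter, Set.mem_union, Set.mem_compl_iff,
          Set.mem_iUnion, Set.mem_inter_iff, Set.mem_preimage, exists_prop, imp_iff_not_or]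
      rw [this]
      refine Finset.measurableSet_biInter _ fun j hj => Finset.measurableSet_biInter _ fun h _ => ?_
      refine (Finset.measurableSet_biUnion _ fun g _ => ?_).compl.union (MeasurableSet.compl ?_)
      · refine ((measurable_const_smul h) (hdepm j hj g)).inter ?_
        by_cases hgh : g * h ∈ W
        · simp only [hgh, true_and]
          exact (measurable_const_smul (g * h)) hU
        · simp only [hgh, false_and]
          exact MeasurableSet.empty
      · refine Measurable.prodMk (measurable_const_smul h) ?_ (hBad j hj)
        refine measurable_pi_lambda _ fun g => ?_
        exact (measurable_pi_apply (g * h)).comp (measurable_patch hψ hU W v)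
    have hex : ∀ m ∈ Mi i, ∃ v, P m v := by
      intro m hm
      let bad : ι × G → Finset (Finset G) := fun p =>
        if ∃ g ∈ dep p.1 (p.2 • m), g * p.2 ∈ W ∧ (g * p.2) • m ∈ U then
          W.powerset.filter fun v => Bad p.1 (p.2 • m) fun g => patch ψ U W v m (g * p.2)
        else ∅
      have hbad : ∀ p ∈ J ×ˢ (N⁻¹ * W), (bad p).card * 2 ^ k ≤ 2 ^ W.card := by
        intro p hp
        simp only [bad]
        split_ifs with hc
        · exact hcount p.1 (Finset.mem_product.1 hp).1 m (hMiM i hm) p.2 hc ψ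
        · simp
      -- Union bound over the fewer than `2 ^ k` constraints that can meet the block.
      have hlt : ((J ×ˢ (N⁻¹ * W)).biUnion bad).card < W.powerset.card := by
        rw [Finset.card_powerset]
        have h1 : ((J ×ˢ (N⁻¹ * W)).biUnion bad).card * 2 ^ k <
            2 ^ W.card * 2 ^ k := by
          calc ((J ×ˢ (N⁻¹ * W)).biUnion bad).card * 2 ^ k
              ≤ (∑ p ∈ J ×ˢ (N⁻¹ * W), (bad p).card) * 2 ^ k :=
                Nat.mul_le_mul_right _ Finset.card_biUnion_le
            _ = ∑ p ∈ J ×ˢ (N⁻¹ * W), (bad p).card * 2 ^ k := Finset.sum_mul _ _ _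
            _ ≤ ∑ p ∈ J ×ˢ (N⁻¹ * W), 2 ^ W.card := Finset.sum_le_sum hbad
            _ = (J.card * (N⁻¹ * W).card) * 2 ^ W.card := by
                rw [Finset.sum_const, Finset.card_product, smul_eq_mul]
            _ < 2 ^ k * 2 ^ W.card := Nat.mul_lt_mul_of_pos_right hk (by positivity)
            _ = 2 ^ W.card * 2 ^ k := mul_comm _ _
        exact Nat.lt_of_mul_lt_mul_right h1
      obtain ⟨v, hv, hvn⟩ := Finset.exists_mem_notMem_of_card_lt_card hlt
      refine ⟨v, fun j hj h hh hc hB => hvn ?_⟩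
      refine Finset.mem_biUnion.2 ⟨(j, h), Finset.mem_product.2 ⟨hj, hh⟩, ?_⟩
      obtain ⟨g, -, hg⟩ := hc
      simp only [bad]
      rw [if_pos ⟨g, hg⟩]
      exact Finset.mem_filter.2 ⟨hv, hB⟩
    obtain ⟨ψ', hψ', hoff, hon⟩ := exists_measurable_assignment hfree (hMi i) hU hψ W
      (fun m hm m' hm' => hdisj m (hMiM i hm) m' (hMiM i hm')) P hP hex
    refine ⟨ψ', hψ', hoff, ?_⟩
    rintro j hj x ⟨g, hg, m, hm, w, hw, hgx, hgU⟩ hB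
    obtain ⟨v, hv, hvW⟩ := hon m hm
    have hx : (g⁻¹ * w) • m = x := by rw [mul_smul, ← hgx, inv_smul_smul]
    have hh : g⁻¹ * w ∈ N⁻¹ * W :=
      Finset.mul_mem_mul (Finset.inv_mem_inv (hdepN j hj x hg)) hw
    subst hx
    have hgw : g * (g⁻¹ * w) = w := by group
    refine hv j hj _ hh ⟨g, hdepN j hj _ hg, hg, ?_, ?_⟩ ?_
    · rw [hgw]; exact hw
    · rw [hgw, ← hgx]; exact hgU
    · refine hdep _ _ _ _ (fun g' hg' => ?_) hB
      rw [smul_smul]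
      by_cases hc : g' * (g⁻¹ * w) ∈ W ∧ (g' * (g⁻¹ * w)) • m ∈ U
      · rw [Bool.eq_iff_iff, hvW _ hc.1 hc.2, patch_of_mem hc.1 hc.2]
      · rw [patch_of_not fun h1 h2 => hc ⟨h1, h2⟩]
        -- A marker of the same class whose block changes `g' • x` lies in `D • m`, hence equals
        -- `m`; so the constraint sees exactly the patch made at `m`.
        refine hoff _ fun m2 hm2 w2 hw2 heq hU2 => hc ⟨?_, hU2⟩
        have hm2' : (w2⁻¹ * g' * g⁻¹ * w) • m = m2 := by
          rw [inv_smul_eq_iff.2 heq.symm |>.symm, smul_smul]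
          congr 1; group
        have h1 : w2⁻¹ * g' * g⁻¹ * w = 1 := by
          refine hMidisc i m hm _ ?_ (hm2'.symm ▸ hm2)
          exact Finset.mul_mem_mul (Finset.mul_mem_mul (Finset.mul_mem_mul
            (Finset.inv_mem_inv hw2) (hdepN j hj _ hg')) (Finset.inv_mem_inv (hdepN j hj _ hg))) hw
        have h2 : g' * (g⁻¹ * w) = w2 := by
          have : w2 * (w2⁻¹ * g' * g⁻¹ * w) = w2 := by rw [h1, mul_one]
          rw [← this]; group
        rw [h2]; exact hw2
  choose! next hnextm hnextoff hnextgood using hstep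
  obtain ⟨Ψ, hΨ0, hΨs⟩ : ∃ Ψ : ℕ → X → Bool, Ψ 0 = φ ∧ ∀ i, Ψ (i + 1) = next i (Ψ i) :=
    ⟨fun i => Nat.rec φ (fun i ψ => next i ψ) i, rfl, fun _ => rfl⟩
  have hΨm : ∀ i, Measurable (Ψ i) := by
    intro i
    induction i with
    | zero => rw [hΨ0]; exact hφ
    | succ i ih => rw [hΨs]; exact hnextm i _ ih
  have hconst : ∀ i n, i ≤ n → ∀ y, (∀ l, i ≤ l → ∀ m ∈ Mi l, ∀ w ∈ W, w • m = y → y ∉ U) →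
      Ψ n y = Ψ i y := by
    intro i n hin y hy
    induction n, hin using Nat.le_induction with
    | base => rfl
    | succ n hn ih => rw [hΨs, hnextoff n _ (hΨm n) y (hy n hn), ih]
  -- Blocks are disjoint and every marker is treated at one stage only, so each value changes at
  -- most once and "eventually true" is its limit.
  let φ' : X → Bool := fun y => decide (∃ i, ∀ n, i ≤ n → Ψ n y = true)
  have hφ'm : Measurable φ' := by
    refine measurable_to_bool ?_
    have : φ' ⁻¹' {true} = ⋃ i, ⋂ n, ⋂ (_ : i ≤ n), (Ψ n) ⁻¹' {true} := by
      ext; simp [φ']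
    rw [this]
    exact MeasurableSet.iUnion fun i => MeasurableSet.iInter fun n => MeasurableSet.iInter fun _ =>
      (hΨm n) (measurableSet_singleton _)
  have hlim : ∀ i y, (∀ l, i ≤ l → ∀ m ∈ Mi l, ∀ w ∈ W, w • m = y → y ∉ U) → φ' y = Ψ i y := by
    intro i y hy
    rw [Bool.eq_iff_iff]
    simp only [φ', decide_eq_true_eq]
    constructor
    · rintro ⟨i', h⟩
      rw [← hconst i (max i i') (le_max_left _ _) y hy]
      exact h _ (le_max_right _ _)
    · intro h
      exact ⟨i, fun n hn => by rw [hconst i n hn y hy, h]⟩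
  refine ⟨φ', hφ'm, fun y hy => (hlim 0 y fun _ _ _ _ _ _ _ => hy).trans (by rw [hΨ0]), ?_⟩
  intro j hj x hx hB
  -- the last stage at which a block meeting the constraint is treated
  let T : Set ℕ := {i | ∃ g ∈ dep j x, ∃ m ∈ Mi i, ∃ w ∈ W, g • x = w • m ∧ g • x ∈ U}
  have hTne : T.Nonempty := by
    obtain ⟨g, hg, m, hm, w, hw, h⟩ := hx
    obtain ⟨i, hi⟩ := hMicov m hm
    exact ⟨i, g, hg, m, hi, w, hw, h⟩
  have hTfin : T.Finite := by
    have hpt : ∀ d : G, {i | d • x ∈ Mi i}.Subsingleton := by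
      intro d i hi i' hi'
      by_contra hne
      exact Set.disjoint_left.1 (disjoint_disjointed A hne) hi.2 hi'.2
    refine Set.Finite.subset ((W⁻¹ * N).finite_toSet.biUnion fun d _ => (hpt d).finite) ?_
    rintro i ⟨g, hg, m, hm, w, hw, h, -⟩
    refine Set.mem_biUnion (Finset.mem_coe.2 (Finset.mul_mem_mul (Finset.inv_mem_inv hw)
      (hdepN j hj x hg))) ?_
    simpa [mul_smul, h] using hm
  -- After stage `i` no coordinate of the constraint changes, so what stage `i` achieved persists in
  -- the limit.
  obtain ⟨i, hiT, himax⟩ := hTfin.exists_maximal hTne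
  refine hnextgood i (Ψ i) (hΨm i) j hj x hiT (hdep _ _ _ _ (fun g hg => ?_) hB)
  rw [← hΨs]
  refine hlim (i + 1) _ fun l hl m hm w hw hwm hU' => ?_
  have := himax (y := l) ⟨g, hg, m, hm, w, hw, hwm.symm, hU'⟩ (by omega)
  change l ≤ i at this
  omega

end Greedy

/-! ### Breaking one period -/

section Aperiodic

lemma measurableSet_finset_eq {G X : Type*} [MeasurableSpace X] {R : X → Finset G} {W : Finset G}
    (hsub : ∀ x, R x ⊆ W) (h : ∀ r ∈ W, MeasurableSet {x | r ∈ R x}) (C : Finset G) :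
    MeasurableSet {x | R x = C} := by
  by_cases hC : C ⊆ W
  · have : {x | R x = C} = ⋂ r ∈ W, {x | r ∈ R x ↔ r ∈ C} := by
      ext x
      simp only [Set.mem_ofPred_eq, Set.mem_iInter]
      refine ⟨fun hx r _ => by rw [hx], fun hx => Finset.ext fun r => ?_⟩
      by_cases hr : r ∈ W
      · exact hx r hr
      · exact ⟨fun h => absurd (hsub x h) hr, fun h => absurd (hC h) hr⟩
    rw [this]
    refine Finset.measurableSet_biInter _ fun r hr => ?_
    by_cases hrC : r ∈ C
    · simpa only [hrC, iff_true] using h r hr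
    · simp only [hrC, iff_false]
      exact (h r hr).compl
  · convert MeasurableSet.empty
    exact Set.eq_empty_of_forall_notMem fun x hx => hC (hx ▸ hsub x)

/-- `R` takes only finitely many values, the subsets of `W`, so the set is a finite union of
measurable rectangles. This makes constraints indexed by a varying finite set Borel. -/
lemma measurableSet_of_finset_valued {G X Y : Type*} [MeasurableSpace X] [MeasurableSpace Y]
    {R : X → Finset G} {W : Finset G}
    (hsub : ∀ x, R x ⊆ W) (h : ∀ r ∈ W, MeasurableSet {x | r ∈ R x}) (p : Finset G → Set Y)
    (hp : ∀ C, MeasurableSet (p C)) : MeasurableSet {q : X × Y | q.2 ∈ p (R q.1)} := by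
  have : {q : X × Y | q.2 ∈ p (R q.1)} = ⋃ C ∈ W.powerset, {x | R x = C} ×ˢ p C := by
    ext q
    simp only [Set.mem_ofPred_eq, Set.mem_iUnion, Set.mem_prod, Finset.mem_powerset, exists_prop]
    exact ⟨fun hq => ⟨R q.1, hsub _, rfl, hq⟩, fun ⟨C, _, h1, h2⟩ => h1 ▸ h2⟩
  rw [this]
  exact Finset.measurableSet_biUnion _ fun C _ => (measurableSet_finset_eq hsub h C).prod (hp C)

variable {G : Type*} [Group G] [Countable G] [Infinite G] {X : Type*} [MeasurableSpace X]
  [StandardBorelSpace X] [MulAction G X] [MeasurableConstSMul G X]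

/-- One step of the construction: given `g ≠ 1` and a syndetic set `U` of free positions, the
values on `U` can be changed, keeping a syndetic set `U'` of positions free, so that `φ` and its
`g`-translate differ inside every `T`-window, whatever values are put on `U'` later. -/
lemma exists_aperiodic_step (hfree : ∀ (g : G) (x : X), g • x = x → g = 1)
    {U : Set X} (hU : MeasurableSet U) {F : Finset G} (hF1 : 1 ∈ F)
    (hF : ∀ x : X, ∃ f ∈ F, f • x ∈ U) {g : G} (hg : g ≠ 1) :
    ∃ U' ⊆ U, MeasurableSet U' ∧ (∃ F' : Finset G, ∀ x : X, ∃ f ∈ F', f • x ∈ U') ∧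
      ∃ T : Finset G, ∀ φ : X → Bool, Measurable φ → ∃ φ' : X → Bool, Measurable φ' ∧
        (∀ y ∉ U, φ' y = φ y) ∧ ∀ φ'' : X → Bool, (∀ y ∉ U', φ'' y = φ' y) →
          ∀ x, ∃ t ∈ T, φ'' (t • x) ≠ φ'' (t • g • x) := by
  classical
  set n := F.card with hn
  -- With `L = n * (K + 1) = n * 6 * k + n * (n + 1)`, at most `4 * L ^ 10` constraints meet a
  -- block; see `hsize`.
  obtain ⟨k, hk1, hk⟩ := exists_poly_lt_two_pow 4 (n * 6) (n * (n + 1)) 10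
  -- Of `K` free positions in a block, at most `n` are compared with a position of `U'`. The other
  -- `6 * k` fall into two classes, one of size at least `3 * k`, and an independent third of it has
  -- size at least `k`.
  set K := 6 * k + n with hK
  obtain ⟨I', hI'card, hI'⟩ := exists_separated F (K + 1)
  -- The translate `F * c` is reserved for the positions left free; the other `K` translates receive
  -- values now.
  obtain ⟨c, hc⟩ : I'.Nonempty := by rw [← Finset.card_pos]; omega
  set I := I'.erase c with hI
  have hIcard : I.card = K := by rw [hI, Finset.card_erase_of_mem hc]; omega
  have hII' : ∀ a ∈ I, a ∈ I' := fun a ha => Finset.mem_of_mem_erase ha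
  set B := F * I' with hB
  set W := F * I with hW
  have hWB : W ⊆ B := Finset.mul_subset_mul_left (Finset.erase_subset _ _)
  set L := n * (K + 1) with hL
  have hBcard : B.card ≤ L := by
    rw [hL, ← hI'card]; exact Finset.card_mul_le
  have hcB : ∀ f ∈ F, f * c ∈ B := fun f hf => Finset.mul_mem_mul hf hc
  -- `B⁻¹ * B` would already make the blocks `B • m` disjoint. The four factors also ensure that a
  -- translated window `W • y` meets at most one block.
  set D := B⁻¹ * B * B⁻¹ * B with hD
  have hmemD : ∀ a ∈ B, ∀ b ∈ B, ∀ a' ∈ B, ∀ b' ∈ B, a⁻¹ * b * a'⁻¹ * b' ∈ D :=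
    fun a ha b hb a' ha' b' hb' => Finset.mul_mem_mul (Finset.mul_mem_mul (Finset.mul_mem_mul
      (Finset.inv_mem_inv ha) hb) (Finset.inv_mem_inv ha')) hb'
  have hD1 : (1 : G) ∈ D := by
    have := hmemD _ (hcB 1 hF1) _ (hcB 1 hF1) _ (hcB 1 hF1) _ (hcB 1 hF1)
    simpa using this
  have hDinv : ∀ d ∈ D, d⁻¹ ∈ D := by
    intro d hd
    have h2 : D⁻¹ = D := by simp only [hD, mul_inv_rev, inv_inv, mul_assoc]
    rw [← h2]
    exact Finset.inv_mem_inv hd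
  obtain ⟨M, -, hM, hMdisc, hMmax⟩ :=
    exists_maximal_discrete hfree D hD1 hDinv (MeasurableSet.univ (α := X))
  -- two blocks of markers are equal as soon as they meet
  have hblock : ∀ m ∈ M, ∀ m' ∈ M, ∀ b ∈ B, ∀ b' ∈ B, b • m = b' • m' → m = m' ∧ b = b' := by
    intro m hm m' hm' b hb b' hb' h
    have h1 : (b'⁻¹ * b) • m = m' := by rw [mul_smul, h, inv_smul_smul]
    have h2 : b'⁻¹ * b * b⁻¹ * b = b'⁻¹ * b := by group
    have h3 : b'⁻¹ * b = 1 := by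
      refine hMdisc m hm _ ?_ (h1.symm ▸ hm')
      rw [← h2]; exact hmemD _ hb' _ hb _ hb _ hb
    rw [h3, one_smul] at h1
    exact ⟨h1, (inv_mul_eq_one.1 h3).symm⟩
  have hdisj : ∀ m ∈ M, ∀ m' ∈ M, ∀ w ∈ W, ∀ w' ∈ W, w • m = w' • m' → m = m' :=
    fun m hm m' hm' w hw w' hw' h => (hblock m hm m' hm' w (hWB hw) w' (hWB hw') h).1
  let V : Set X := {y | ∃ w ∈ W, w⁻¹ • y ∈ M}
  have hV : MeasurableSet V := by
    have : V = ⋃ w ∈ W, (w⁻¹ • ·) ⁻¹' M := by ext; simp [V]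
    rw [this]
    exact Finset.measurableSet_biUnion _ fun w _ => (measurable_const_smul _) hM
  let U' : Set X := {y | y ∈ U ∧ ∃ f ∈ F, (f * c)⁻¹ • y ∈ M}
  have hU' : MeasurableSet U' := by
    have : U' = U ∩ ⋃ f ∈ F, ((f * c)⁻¹ • ·) ⁻¹' M := by
      ext
      simp only [U', Set.mem_ofPred_eq, Set.mem_inter_iff, Set.mem_iUnion, Set.mem_preimage,
        exists_prop]
    rw [this]
    exact hU.inter (Finset.measurableSet_biUnion _ fun w _ => (measurable_const_smul _) hM)
  have hVU' : ∀ y ∈ V, y ∉ U' := by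
    rintro y ⟨w, hw, hwy⟩ ⟨-, f, hf, hfy⟩
    obtain ⟨f', hf', a, ha, rfl⟩ := Finset.mem_mul.1 hw
    have := (hblock _ hwy _ hfy _ (hWB hw) _ (hcB f hf)
      (by rw [smul_inv_smul, smul_inv_smul])).2
    have h2 := hI' a (hII' a ha) c hc f' hf' f hf this
    rw [h2] at ha
    simp [hI] at ha
  have hWM : ∀ m ∈ M, ∀ w ∈ W, w • m ∈ V := fun m hm w hw => ⟨w, hw, by simpa using hm⟩
  -- Seen from a marker `m = p • x`, translation by `g` at `x` becomes translation by `s = p * g *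
  -- p⁻¹`: `(r * p) • g • x = (r * s) • m`.
  let S : Finset G := D.image fun p => p * g * p⁻¹
  have hS1 : ∀ s ∈ S, s ≠ 1 := by
    intro s hs h1
    obtain ⟨p, -, rfl⟩ := Finset.mem_image.1 hs
    exact hg (by simpa using h1)
  -- At a marker, `true` means that the second position is free in a different block; `false` means
  -- that it lies in the same block or keeps its prescribed value. Both exclude `U'`.
  let cond : Bool → G → X → G → Prop := fun b s x r =>
    if b then r * s ∉ W ∧ (r * s) • x ∈ U ∧ (r * s) • x ∈ V
    else (r * s) • x ∉ U' ∧ ((r * s) • x ∈ U → (r * s) • x ∈ V → r * s ∈ W)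
  let R : G × Bool → X → Finset G := fun j x => W.filter fun r => r • x ∈ U ∧ cond j.2 j.1 x r
  have hRW : ∀ j x, R j x ⊆ W := fun j x => Finset.filter_subset _ _
  have hRm : ∀ j, ∀ r ∈ W, MeasurableSet {x | r ∈ R j x} := by
    rintro ⟨s, b⟩ r hr
    have e1 : MeasurableSet {x : X | r • x ∈ U} := (measurable_const_smul r) hU
    have e2 : MeasurableSet {x : X | (r * s) • x ∈ U} := (measurable_const_smul (r * s)) hU
    have e3 : MeasurableSet {x : X | (r * s) • x ∈ V} := (measurable_const_smul (r * s)) hV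
    have e4 : MeasurableSet {x : X | (r * s) • x ∈ U'} := (measurable_const_smul (r * s)) hU'
    simp only [R, Finset.mem_filter, hr, true_and]
    refine e1.inter ?_
    cases b
    · exact e4.compl.inter (e2.imp (e3.imp (MeasurableSet.const _)))
    · exact (MeasurableSet.const _).inter (e2.inter e3)
  let Bad : G × Bool → X → (G → Bool) → Prop := fun j x u =>
    x ∈ M ∧ 3 * k ≤ (R j x).card ∧ ∀ r ∈ R j x, u r = u (r * j.1)
  -- The set is empty unless `x` is a marker with at least `3 * k` comparisons, so other constraints
  -- are never met.
  let dep : G × Bool → X → Set G := fun j x =>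
    {g' | x ∈ M ∧ 3 * k ≤ (R j x).card ∧ ∃ r ∈ R j x, g' = r ∨ g' = r * j.1}
  let N : Finset G := W ∪ W * S
  let J : Finset (G × Bool) := S ×ˢ Finset.univ
  have hsize : J.card * (N⁻¹ * W).card < 2 ^ k := by
    have hWL : W.card ≤ L := (Finset.card_le_card hWB).trans hBcard
    have hDL : D.card ≤ L ^ 4 := by
      have hBi : B⁻¹.card ≤ L := by rw [Finset.card_inv]; exact hBcard
      calc D.card ≤ B⁻¹.card * B.card * B⁻¹.card * B.card := by
            refine Finset.card_mul_le.trans (Nat.mul_le_mul_right _ ?_)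
            refine Finset.card_mul_le.trans (Nat.mul_le_mul_right _ ?_)
            exact Finset.card_mul_le
        _ ≤ L * L * L * L := by gcongr
        _ = L ^ 4 := by ring
    have hSL : S.card ≤ L ^ 4 := Finset.card_image_le.trans hDL
    have hJL : J.card ≤ 2 * L ^ 4 := by
      rw [Finset.card_product, Finset.card_univ, Fintype.card_bool]; omega
    have hNL : N.card ≤ 2 * L ^ 5 := by
      calc N.card ≤ W.card + W.card * S.card :=
            (Finset.card_union_le _ _).trans (Nat.add_le_add le_rfl Finset.card_mul_le)
        _ ≤ L + L * L ^ 4 := by gcongr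
        _ ≤ L ^ 5 + L ^ 5 := by
            refine Nat.add_le_add ?_ (le_of_eq (by ring))
            exact Nat.le_self_pow (by norm_num) _
        _ = 2 * L ^ 5 := by ring
    calc J.card * (N⁻¹ * W).card ≤ (2 * L ^ 4) * ((2 * L ^ 5) * L) := by
          refine Nat.mul_le_mul hJL (Finset.card_mul_le.trans (Nat.mul_le_mul ?_ hWL))
          rw [Finset.card_inv]; exact hNL
      _ = 4 * (n * 6 * k + n * (n + 1)) ^ 10 := by rw [hL, hK]; ring
      _ < 2 ^ k := hk
  have hcount : ∀ j ∈ J, ∀ m ∈ M, ∀ h : G,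
      (∃ g ∈ dep j (h • m), g * h ∈ W ∧ (g * h) • m ∈ U) → ∀ ψ : X → Bool,
      (W.powerset.filter fun v => Bad j (h • m) fun g => patch ψ U W v m (g * h)).card * 2 ^ k
        ≤ 2 ^ W.card := by
    rintro ⟨s, b⟩ hj m hm h ⟨g0, ⟨hx, hRk, r0, hr0, hg0⟩, hg0W, hg0U⟩ ψ
    have hs1 : s ≠ 1 := hS1 s (Finset.mem_product.1 hj).1
    -- In a violating assignment the values on `C` are determined by those off `C`, so violations
    -- have density at most `2 ^ (-k)`.
    suffices hC : ∃ C ⊆ W, k ≤ C.card ∧ ∀ v v' : Finset G,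
        (Bad (s, b) (h • m) fun g => patch ψ U W v m (g * h)) →
        (Bad (s, b) (h • m) fun g => patch ψ U W v' m (g * h)) → v \ C = v' \ C →
        ∀ a ∈ C, a ∈ v → a ∈ v' by
      obtain ⟨C, hCW, hkC, hCv⟩ := hC
      refine le_trans (Nat.mul_le_mul_left _ (Nat.pow_le_pow_right (by norm_num) hkC))
        (card_mul_two_pow_le hCW (Finset.filter_subset _ _) ?_)
      intro v hv v' hv' heq
      ext a
      by_cases ha : a ∈ C
      · exact ⟨hCv v v' (Finset.mem_filter.1 hv).2 (Finset.mem_filter.1 hv').2 heq a ha,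
          hCv v' v (Finset.mem_filter.1 hv').2 (Finset.mem_filter.1 hv).2 heq.symm a ha⟩
      · have := Finset.ext_iff.1 heq a
        simpa [ha] using this
    have hsame : ∀ r ∈ W, r * h ∈ W → h = 1 := by
      intro r hr hrh
      have h1 := hdisj m hm _ hx _ hrh r hr (by rw [mul_smul])
      exact hfree h m h1.symm
    have hr0W : r0 ∈ W := hRW _ _ hr0
    cases b
    · -- the constraint compares the block with itself and with prescribed values
      have hh : h = 1 := by
        rcases hg0 with rfl | rfl
        · exact hsame _ hr0W hg0W
        · have hr0' := (Finset.mem_filter.1 hr0).2.2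
          simp only [cond, Bool.false_eq_true, if_false] at hr0'
          refine hsame _ (hr0'.2 ?_ ?_) hg0W
          · rw [smul_smul]; exact hg0U
          · rw [smul_smul]; exact hWM m hm _ hg0W
      subst hh
      -- Independence puts the partner `a * s` of each `a ∈ C` outside `C`, where the two
      -- assignments agree.
      obtain ⟨C, hCR, hC3, hCs⟩ := exists_independent_subset hs1 (R (s, false) ((1 : G) • m))
      refine ⟨C, hCR.trans (hRW _ _), by omega, fun v v' hv hv' heq a ha hav => ?_⟩
      have haW : a ∈ W := hRW _ _ (hCR ha)
      have haU : a • m ∈ U := by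
        have := (Finset.mem_filter.1 (hCR ha)).2.1
        rwa [one_smul] at this
      have e1 := hv.2.2 a (hCR ha)
      have e2 := hv'.2.2 a (hCR ha)
      simp only [mul_one] at e1 e2
      have e3 : patch ψ U W v m (a * s) = patch ψ U W v' m (a * s) := by
        by_cases hc : a * s ∈ W ∧ (a * s) • m ∈ U
        · rw [Bool.eq_iff_iff, patch_of_mem hc.1 hc.2, patch_of_mem hc.1 hc.2]
          have := Finset.ext_iff.1 heq (a * s)
          simpa [hCs a ha] using this
        · rw [patch_of_not fun h1 h2 => hc ⟨h1, h2⟩, patch_of_not fun h1 h2 => hc ⟨h1, h2⟩]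
      rw [← patch_of_mem haW haU] at hav ⊢
      rw [e2, ← e3, ← e1, hav]
    · -- the constraint compares two different blocks
      have hR : ∀ r ∈ R (s, true) (h • m), r • h • m ∈ U ∧ r * s ∉ W ∧
          (r * s) • h • m ∈ U ∧ (r * s) • h • m ∈ V := by
        intro r hr
        have := (Finset.mem_filter.1 hr).2
        simpa only [cond, if_true] using this
      rcases hg0 with rfl | rfl
      · have hh := hsame _ hr0W hg0W
        subst hh
        refine ⟨R (s, true) ((1 : G) • m), hRW _ _, by omega, fun v v' hv hv' heq a ha hav => ?_⟩
        have haW : a ∈ W := hRW _ _ ha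
        have haU : a • m ∈ U := by simpa using (hR a ha).1
        have e1 := hv.2.2 a ha
        have e2 := hv'.2.2 a ha
        simp only [mul_one] at e1 e2
        rw [← patch_of_mem haW haU] at hav ⊢
        rw [e2, patch_of_not fun h1 => absurd h1 (hR a ha).2.1]
        rw [e1, patch_of_not fun h1 => absurd h1 (hR a ha).2.1] at hav
        exact hav
      -- Here the block at `m` holds the second positions. It holds all of them, since a translated
      -- window meets only one block.
      · have hrsh : ∀ r ∈ R (s, true) (h • m), r * s * h ∈ W := by
          intro r hr
          obtain ⟨w, hw, hwM⟩ := (hR r hr).2.2.2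
          have h1 : w⁻¹ • (r * s) • h • m = (w⁻¹ * r * r0⁻¹ * (r0 * s * h)) • m := by
            simp only [smul_smul]; congr 1; group
          rw [h1] at hwM
          have h2 := hMdisc m hm _ (hmemD _ (hWB hw) _ (hWB (hRW _ _ hr)) _ (hWB hr0W) _
            (hWB hg0W)) hwM
          have h3 : r * s * h = w := by
            have : w * (w⁻¹ * r * r0⁻¹ * (r0 * s * h)) = w := by rw [h2, mul_one]
            rw [← this]; group
          rw [h3]; exact hw
        refine ⟨(R (s, true) (h • m)).image fun r => r * s * h, ?_, ?_, ?_⟩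
        · intro a ha
          obtain ⟨r, hr, rfl⟩ := Finset.mem_image.1 ha
          exact hrsh r hr
        · rw [Finset.card_image_of_injective _ fun a b hab => by simpa using hab]
          omega
        · intro v v' hv hv' heq a ha hav
          obtain ⟨r, hr, rfl⟩ := Finset.mem_image.1 ha
          have hrh : r * h ∉ W := by
            intro hcon
            have hh := hsame r (hRW _ _ hr) hcon
            have := hrsh r hr
            rw [hh, mul_one] at this
            exact (hR r hr).2.1 this
          have hrU : (r * s * h) • m ∈ U := by
            rw [mul_smul]; exact (hR r hr).2.2.1
          have e1 := hv.2.2 r hr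
          have e2 := hv'.2.2 r hr
          simp only at e1 e2
          rw [← patch_of_mem (hrsh r hr) hrU] at hav ⊢
          rw [← e2, patch_of_not fun h1 => absurd h1 hrh]
          rw [← e1, patch_of_not fun h1 => absurd h1 hrh] at hav
          exact hav
  refine ⟨U', fun y hy => hy.1, hU', ⟨F * {c} * D, fun x => ?_⟩, W * D, fun φ hφ => ?_⟩
  · obtain ⟨d, hd, hdx⟩ := hMmax x trivial
    obtain ⟨f, hf, hfU⟩ := hF (c • d • x)
    refine ⟨f * c * d, Finset.mul_mem_mul (Finset.mul_mem_mul hf (Finset.mem_singleton_self c)) hd,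
      ?_, f, hf, ?_⟩
    · simpa [mul_smul] using hfU
    · simpa [mul_smul] using hdx
  obtain ⟨φ', hφ', hoff, hgood⟩ := exists_measurable_greedy hfree hM hU hφ W N hdisj J Bad dep
    (by
      rintro ⟨s, b⟩ hj x g' ⟨hx, hk', r, hr, rfl | rfl⟩
      · exact Finset.mem_union_left _ (hRW _ _ hr)
      · exact Finset.mem_union_right _
          (Finset.mul_mem_mul (hRW _ _ hr) (Finset.mem_product.1 hj).1))
    (by
      rintro j x u u' huu' ⟨hx, hk', h⟩
      refine ⟨hx, hk', fun r hr => ?_⟩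
      rw [← huu' r ⟨hx, hk', r, hr, Or.inl rfl⟩, ← huu' _ ⟨hx, hk', r, hr, Or.inr rfl⟩]
      exact h r hr)
    (by
      intro j _
      have := measurableSet_of_finset_valued (hRW j) (hRm j)
        (fun C => {u : G → Bool | 3 * k ≤ C.card ∧ ∀ r ∈ C, u r = u (r * j.1)}) fun C =>
          (isClopen_of_finite_dep (C ∪ C.image (· * j.1)) _ fun u u' huu' => by
            refine and_congr_right fun _ => forall₂_congr fun r hr => ?_
            rw [huu' r (Finset.mem_union_left _ hr),
              huu' _ (Finset.mem_union_right _ (Finset.mem_image_of_mem _ hr))]).isOpen.measurableSet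
      exact (hM.preimage measurable_fst).inter this)
    (by
      intro j _ g'
      have := measurableSet_of_finset_valued (Y := Unit) (hRW j) (hRm j)
        (fun C => {_u : Unit | 3 * k ≤ C.card ∧ ∃ r ∈ C, g' = r ∨ g' = r * j.1}) fun C =>
          MeasurableSet.const _
      exact hM.inter (measurable_prodMk_right (y := ()) this))
    k hsize (fun j hj m hm h hx ψ => by convert hcount j hj m hm h hx ψ)
  refine ⟨φ', hφ', hoff, fun φ'' hφ'' x => ?_⟩
  obtain ⟨p, hp, hpx⟩ := hMmax x trivial
  set m := p • x with hm
  set s := p * g * p⁻¹ with hs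
  have hsS : s ∈ S := Finset.mem_image_of_mem _ hp
  have hcard : ∃ b, 3 * k ≤ (R (s, b) m).card := by
    have h1 : K ≤ (W.filter fun r => r • m ∈ U).card := by
      have hch : ∀ a : G, ∃ f ∈ F, f • a • m ∈ U := fun a => hF (a • m)
      choose fa hfa hfaU using hch
      rw [← hIcard]
      refine Finset.card_le_card_of_injOn (fun a => fa a * a) ?_ ?_
      · intro a ha
        refine Finset.mem_coe.2 (Finset.mem_filter.2 ⟨Finset.mul_mem_mul (hfa a) ha, ?_⟩)
        rw [mul_smul]; exact hfaU a
      · intro a ha a' ha' h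
        exact hI' a (hII' a ha) a' (hII' a' ha') _ (hfa a) _ (hfa a') h
    -- All these positions of `U'` belong to one marker, so `r` is determined by an element of `F`.
    have h2 : (W.filter fun r => (r * s) • m ∈ U').card ≤ n := by
      rcases (W.filter fun r => (r * s) • m ∈ U').eq_empty_or_nonempty with h0 | ⟨r0, hr0⟩
      · rw [h0]; simp
      obtain ⟨hr0W, -, f0, hf0, hf0M⟩ := Finset.mem_filter.1 hr0
      refine (Finset.card_le_card ?_).trans (Finset.card_image_le (s := F)
        (f := fun f => f * f0⁻¹ * r0))
      intro r hr
      obtain ⟨hrW, -, f, hf, hfM⟩ := Finset.mem_filter.1 hr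
      refine Finset.mem_image.2 ⟨f, hf, ?_⟩
      have h3 : (f * c)⁻¹ • (r * s) • m =
          ((f * c)⁻¹ * r * r0⁻¹ * (f0 * c)) • (f0 * c)⁻¹ • (r0 * s) • m := by
        simp only [smul_smul]; congr 1; group
      rw [h3] at hfM
      have h4 := hMdisc _ hf0M _ (hmemD _ (hcB f hf) _ (hWB hrW) _ (hWB hr0W) _ (hcB f0 hf0)) hfM
      have h5 : r * r0⁻¹ = f * f0⁻¹ := by
        have : (f * c) * ((f * c)⁻¹ * r * r0⁻¹ * (f0 * c)) * (f0 * c)⁻¹ =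
          (f * c) * (f0 * c)⁻¹ := by rw [h4, mul_one]
        calc r * r0⁻¹ = (f * c) * ((f * c)⁻¹ * r * r0⁻¹ * (f0 * c)) * (f0 * c)⁻¹ := by group
          _ = _ := this
          _ = f * f0⁻¹ := by group
      change f * f0⁻¹ * r0 = r
      rw [← h5]; group
    have h3 : (W.filter fun r => r • m ∈ U) ⊆
        (R (s, true) m ∪ R (s, false) m) ∪ W.filter fun r => (r * s) • m ∈ U' := by
      intro r hr
      obtain ⟨hrW, hrU⟩ := Finset.mem_filter.1 hr
      simp only [Finset.mem_union, R, cond, Finset.mem_filter, hrW, hrU, true_and, if_true,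
        Bool.false_eq_true, if_false]
      tauto
    have h4 := (Finset.card_le_card h3).trans ((Finset.card_union_le _ _).trans
      (Nat.add_le_add (Finset.card_union_le _ _) le_rfl))
    by_contra! hcon
    have h5 := hcon true
    have h6 := hcon false
    omega
  obtain ⟨b, hb⟩ := hcard
  have hne : (R (s, b) m).Nonempty := by rw [← Finset.card_pos]; omega
  obtain ⟨r0, hr0⟩ := hne
  have hnb := hgood (s, b) (Finset.mem_product.2 ⟨hsS, Finset.mem_univ _⟩) m
    ⟨r0, ⟨hpx, hb, r0, hr0, Or.inl rfl⟩, m, hpx, r0, hRW _ _ hr0, rfl,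
      (Finset.mem_filter.1 hr0).2.1⟩
  have hnb2 : ∃ r ∈ R (s, b) m, φ' (r • m) ≠ φ' ((r * s) • m) := by
    by_contra! hcon
    exact hnb ⟨hpx, hb, hcon⟩
  obtain ⟨r, hr, hne⟩ := hnb2
  obtain ⟨hrW, hrU, hrc⟩ := Finset.mem_filter.1 hr
  refine ⟨r * p, Finset.mul_mem_mul hrW hp, ?_⟩
  have e1 : (r * p) • x = r • m := by rw [hm, mul_smul]
  have e2 : (r * p) • g • x = (r * s) • m := by
    rw [hm, hs]; simp only [smul_smul]; congr 1; group
  rw [e1, e2, hφ'' _ (hVU' _ (hWM m hpx r hrW)), hφ'']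
  · exact hne
  · cases b
    · simp only [cond, Bool.false_eq_true, if_false] at hrc
      exact hrc.1
    · simp only [cond, if_true] at hrc
      exact hVU' _ hrc.2.2

end Aperiodic

/-! ### Coding one bit by parities -/

section Coding

/-- The window `F * a` of the pattern `u` has odd parity. -/
def OddAt {G : Type*} [Group G] (F : Finset G) (u : G → Bool) (a : G) : Prop :=
  Odd (F.filter fun f => u (f * a) = true).card

lemma oddAt_congr {G : Type*} [Group G] {F : Finset G} {u u' : G → Bool} {a a' : G}
    (h : ∀ f ∈ F, u (f * a) = u' (f * a')) : OddAt F u a ↔ OddAt F u' a' := by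
  have : (F.filter fun f => u (f * a) = true) = F.filter fun f => u' (f * a') = true :=
    Finset.filter_congr fun f hf => by rw [h f hf]
  rw [OddAt, OddAt, this]

/-- Changing exactly one value in a window changes its parity. -/
lemma oddAt_flip {G : Type*} [Group G] {F : Finset G} {u u' : G → Bool} {a f₀ : G}
    (hf₀ : f₀ ∈ F) (h : ∀ f ∈ F, f ≠ f₀ → u (f * a) = u' (f * a)) (h1 : u (f₀ * a) = true)
    (h2 : u' (f₀ * a) = false) : OddAt F u a ↔ ¬ OddAt F u' a := by
  classical
  have : (F.filter fun f => u (f * a) = true) =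
      insert f₀ (F.filter fun f => u' (f * a) = true) := by
    ext f
    rw [Finset.mem_insert, Finset.mem_filter, Finset.mem_filter]
    by_cases hf : f = f₀
    · simp [hf, hf₀, h1]
    · simp only [hf, false_or]
      exact and_congr_right fun hfF => by rw [h f hfF hf]
  rw [OddAt, OddAt, this, Finset.card_insert_of_notMem (by simp [h2]), Nat.odd_add_one]

lemma isClopen_oddAt {G : Type*} [Group G] (F : Finset G) (a : G) :
    IsClopen {u : G → Bool | OddAt F u a} := by
  classical
  refine isClopen_of_finite_dep (F.image (· * a)) _ fun u u' h => oddAt_congr fun f hf => ?_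
  exact h _ (Finset.mem_image_of_mem _ hf)

variable {G : Type*} [Group G] [Countable G] [Infinite G] {X : Type*} [MeasurableSpace X]
  [StandardBorelSpace X] [MulAction G X] [MeasurableConstSMul G X]

/-- One step of the construction: given a syndetic set `U` of free positions, one bit `b` can be
coded into the values on `U`, keeping a syndetic set `U'` of positions free, so that `b` can be read
off from any finite window of a given shape (by means of the clopen set `Q`),
whatever values are put on `U'` later. -/
lemma exists_coding_step (hfree : ∀ (g : G) (x : X), g • x = x → g = 1)
    {U : Set X} (hU : MeasurableSet U) {F : Finset G} (hF1 : 1 ∈ F)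
    (hF : ∀ x : X, ∃ f ∈ F, f • x ∈ U) :
    ∃ U' ⊆ U, MeasurableSet U' ∧ (∃ F' : Finset G, ∀ x : X, ∃ f ∈ F', f • x ∈ U') ∧
      ∃ Q : Set (G → Bool), IsClopen Q ∧ ∀ φ : X → Bool, Measurable φ → ∀ b : Bool,
        ∃ φ' : X → Bool, Measurable φ' ∧ (∀ y ∉ U, φ' y = φ y) ∧
          ∀ φ'' : X → Bool, (∀ y ∉ U', φ'' y = φ' y) →
            ∀ x, ((fun g : G => φ'' (g⁻¹ • x)) ∈ Q ↔ b = true) := by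
  classical
  set n := F.card with hn
  -- At a given shift `p ∈ P` all `K` windows are odd for a proportion at most `2 ^ (-K)` of the
  -- assignments, and there are at most `2 * (n * K) ^ 2` shifts.
  obtain ⟨K, hK1, hK⟩ := exists_poly_lt_two_pow 2 n 0 2
  obtain ⟨I, hIcard, hI⟩ := exists_separated F K
  set W := F * I with hW
  have hWmem : ∀ f ∈ F, ∀ a ∈ I, f * a ∈ W := fun f hf a ha => Finset.mul_mem_mul hf ha
  set E := W⁻¹ * W with hE
  have hEmem : ∀ w ∈ W, ∀ w' ∈ W, w⁻¹ * w' ∈ E := fun w hw w' hw' =>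
    Finset.mul_mem_mul (Finset.inv_mem_inv hw) hw'
  have hE1 : (1 : G) ∈ E := by
    obtain ⟨a, ha⟩ : I.Nonempty := by rw [← Finset.card_pos]; omega
    simpa using hEmem _ (hWmem 1 hF1 a ha) _ (hWmem 1 hF1 a ha)
  have hEinv : ∀ d ∈ E, d⁻¹ ∈ E := by
    intro d hd
    have h2 : E⁻¹ = E := by simp only [hE, mul_inv_rev, inv_inv]
    rw [← h2]
    exact Finset.inv_mem_inv hd
  -- This choice makes `W • y` or `W • q • y` avoid `U'`, for every `y`.
  obtain ⟨q, hq⟩ := Infinite.exists_notMem_finset (W⁻¹ * F * F⁻¹ * W)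
  set P := E ∪ E * {q} with hP
  have hPcard : P.card < 2 ^ K := by
    have hEc : E.card ≤ (n * K) ^ 2 := by
      have hWc : W.card ≤ n * K := by rw [← hIcard]; exact Finset.card_mul_le
      calc E.card ≤ W⁻¹.card * W.card := Finset.card_mul_le
        _ ≤ (n * K) * (n * K) := by rw [Finset.card_inv]; gcongr
        _ = _ := by ring
    calc P.card ≤ E.card + E.card * 1 :=
          (Finset.card_union_le _ _).trans (Nat.add_le_add le_rfl Finset.card_mul_le)
      _ ≤ 2 * (n * K + 0) ^ 2 := by rw [add_zero]; omega
      _ < 2 ^ K := hK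
  -- `F * c` is disjoint from `W * P`, so the windows read around a marker of `M'` avoid the
  -- positions left free.
  obtain ⟨c, hc⟩ := Infinite.exists_notMem_finset (F⁻¹ * (W * P))
  set B := W * P ∪ F * {c} with hB
  have hWPB : ∀ w ∈ W, ∀ p ∈ P, w * p ∈ B := fun w hw p hp =>
    Finset.mem_union_left _ (Finset.mul_mem_mul hw hp)
  have hcB : ∀ f ∈ F, f * c ∈ B := fun f hf =>
    Finset.mem_union_right _ (Finset.mul_mem_mul hf (Finset.mem_singleton_self c))
  -- The first part makes the blocks disjoint. The second forces a common marker if both `W • y` and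
  -- `W • q • y` meet `U'`, which the choice of `q` rules out.
  set D₀ := B⁻¹ * B ∪ (W⁻¹ * (F * {c}))⁻¹ * {q} * (W⁻¹ * (F * {c})) with hD₀
  set D := insert 1 (D₀ ∪ D₀⁻¹) with hD
  have hD₀D : ∀ d ∈ D₀, d ∈ D := fun d hd =>
    Finset.mem_insert_of_mem (Finset.mem_union_left _ hd)
  have hDinv : ∀ d ∈ D, d⁻¹ ∈ D := by
    intro d hd
    simp only [hD, Finset.mem_insert, Finset.mem_union, Finset.mem_inv', inv_inv, inv_eq_one]
      at hd ⊢
    tauto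
  obtain ⟨M', -, hM', hM'disc, hM'max⟩ :=
    exists_maximal_discrete hfree D (Finset.mem_insert_self _ _) hDinv
      (MeasurableSet.univ (α := X))
  have hblock : ∀ m ∈ M', ∀ m' ∈ M', ∀ b ∈ B, ∀ b' ∈ B, b • m = b' • m' → m = m' ∧ b = b' := by
    intro m hm m' hm' b hb b' hb' h
    have h1 : (b'⁻¹ * b) • m = m' := by rw [mul_smul, h, inv_smul_smul]
    have h3 : b'⁻¹ * b = 1 := hM'disc m hm _ (hD₀D _ (Finset.mem_union_left _
      (Finset.mul_mem_mul (Finset.inv_mem_inv hb') hb))) (h1.symm ▸ hm')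
    rw [h3, one_smul] at h1
    exact ⟨h1, (inv_mul_eq_one.1 h3).symm⟩
  let U' : Set X := {y | y ∈ U ∧ ∃ f ∈ F, (f * c)⁻¹ • y ∈ M'}
  have hU' : MeasurableSet U' := by
    have : U' = U ∩ ⋃ f ∈ F, ((f * c)⁻¹ • ·) ⁻¹' M' := by
      ext
      simp only [U', Set.mem_ofPred_eq, Set.mem_inter_iff, Set.mem_iUnion, Set.mem_preimage,
        exists_prop]
    rw [this]
    exact hU.inter (Finset.measurableSet_biUnion _ fun w _ => (measurable_const_smul _) hM')
  have hWPU' : ∀ m ∈ M', ∀ w ∈ W, ∀ p ∈ P, (w * p) • m ∉ U' := by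
    rintro m hm w hw p hp ⟨-, f, hf, hfm⟩
    have h1 := (hblock m hm _ hfm _ (hWPB w hw p hp) _ (hcB f hf) (by rw [smul_inv_smul])).2
    apply hc
    have : c = f⁻¹ * (w * p) := by rw [h1]; group
    rw [this]
    exact Finset.mul_mem_mul (Finset.inv_mem_inv hf) (Finset.mul_mem_mul hw hp)
  -- At points of `Z` the whole window `W` is immune to later changes.
  let Z : Set X := {x | ∀ w ∈ W, w • x ∉ U'}
  have hZ : MeasurableSet Z := by
    have : Z = ⋂ w ∈ W, ((w • ·) ⁻¹' U')ᶜ := by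
      ext
      simp only [Z, Set.mem_ofPred_eq, Set.mem_iInter, Set.mem_compl_iff, Set.mem_preimage]
    rw [this]
    exact Finset.measurableSet_biInter _ fun w _ => ((measurable_const_smul w) hU').compl
  obtain ⟨M, hMZ, hM, hMdisc, hMmax⟩ := exists_maximal_discrete hfree E hE1 hEinv hZ
  have hPM : ∀ y : X, ∃ p ∈ P, p • y ∈ M := by
    intro y
    by_cases hy : y ∈ Z
    · obtain ⟨d, hd, hdy⟩ := hMmax y hy
      exact ⟨d, Finset.mem_union_left _ hd, hdy⟩
    have hqy : q • y ∈ Z := by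
      rintro w' hw' ⟨-, f', hf', hm'⟩
      apply hy
      rintro w hw ⟨-, f, hf, hm⟩
      have h1 : (f' * c)⁻¹ • w' • q • y =
          ((w'⁻¹ * (f' * c))⁻¹ * q * (w⁻¹ * (f * c))) • (f * c)⁻¹ • w • y := by
        simp only [smul_smul]; congr 1; group
      rw [h1] at hm'
      have h2 := hM'disc _ hm _ (hD₀D _ (Finset.mem_union_right _ (Finset.mul_mem_mul
        (Finset.mul_mem_mul (Finset.inv_mem_inv (Finset.mul_mem_mul (Finset.inv_mem_inv hw')
          (Finset.mul_mem_mul hf' (Finset.mem_singleton_self c)))) (Finset.mem_singleton_self q))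
        (Finset.mul_mem_mul (Finset.inv_mem_inv hw)
          (Finset.mul_mem_mul hf (Finset.mem_singleton_self c)))))) hm'
      apply hq
      have h3 : q = w'⁻¹ * f' * f⁻¹ * w := by
        have : (w'⁻¹ * (f' * c)) * ((w'⁻¹ * (f' * c))⁻¹ * q * (w⁻¹ * (f * c))) *
            (w⁻¹ * (f * c))⁻¹ = (w'⁻¹ * (f' * c)) * (w⁻¹ * (f * c))⁻¹ := by rw [h2, mul_one]
        calc q = (w'⁻¹ * (f' * c)) * ((w'⁻¹ * (f' * c))⁻¹ * q * (w⁻¹ * (f * c))) *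
              (w⁻¹ * (f * c))⁻¹ := by group
          _ = _ := this
          _ = _ := by group
      rw [h3]
      exact Finset.mul_mem_mul (Finset.mul_mem_mul (Finset.mul_mem_mul (Finset.inv_mem_inv hw') hf')
        (Finset.inv_mem_inv hf)) hw
    obtain ⟨d, hd, hdy⟩ := hMmax _ hqy
    exact ⟨d * q, Finset.mem_union_right _ (Finset.mul_mem_mul hd (Finset.mem_singleton_self q)),
      by rwa [mul_smul]⟩
  -- Bit `true` means that every `t • x` has a nearby shift with all `K` windows odd. To code
  -- `false` it is enough to prevent this at markers of `M'`, since some `t ∈ D` carries `x` into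
  -- `M'`.
  let Q : Set (G → Bool) := {u | ∀ t ∈ D, ∃ p ∈ P, ∀ a ∈ I, OddAt F (fun g => u g⁻¹) (a * (p * t))}
  have hQ : IsClopen Q := by
    have : Q = ⋂ t ∈ D, ⋃ p ∈ P, ⋂ a ∈ I,
        (fun (u : G → Bool) g => u g⁻¹) ⁻¹' {u | OddAt F u (a * (p * t))} := by
      ext
      simp only [Q, Set.mem_ofPred_eq, Set.mem_iInter, Set.mem_iUnion, Set.mem_preimage,
        exists_prop]
    rw [this]
    refine isClopen_biInter_finset fun t _ => isClopen_biUnion_finset fun p _ =>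
      isClopen_biInter_finset fun a _ => (isClopen_oddAt F _).preimage ?_
    exact continuous_pi fun g => continuous_apply _
  have hQiff : ∀ (ψ : X → Bool) (x : X), (fun g : G => ψ (g⁻¹ • x)) ∈ Q ↔
      ∀ t ∈ D, ∃ p ∈ P, ∀ a ∈ I, OddAt F (fun g => ψ (g • p • t • x)) a := by
    intro ψ x
    refine forall₂_congr fun t _ => exists_congr fun p => and_congr_right fun _ =>
      forall₂_congr fun a _ => oddAt_congr fun f _ => ?_
    simp only [inv_inv, mul_smul]
  refine ⟨U', fun y hy => hy.1, hU', ⟨F * {c} * D, fun x => ?_⟩, Q, hQ, fun φ hφ b => ?_⟩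
  · obtain ⟨d, hd, hdx⟩ := hM'max x trivial
    obtain ⟨f, hf, hfU⟩ := hF (c • d • x)
    refine ⟨f * c * d, Finset.mul_mem_mul (Finset.mul_mem_mul hf (Finset.mem_singleton_self c)) hd,
      ?_, f, hf, ?_⟩
    · simpa [mul_smul] using hfU
    · simpa [mul_smul] using hdx
  cases b
  · -- avoid the odd windows near every marker in `M'`
    let A : X → Finset G → Prop := fun m v =>
      ∀ p ∈ P, ∃ a ∈ I, ¬ OddAt F (patch φ U (W * P) v m) (a * p)
    have hA : ∀ v, MeasurableSet {x | A x v} := by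
      intro v
      have : {x | A x v} = ⋂ p ∈ P, ⋃ a ∈ I, ((fun m => patch φ U (W * P) v m) ⁻¹'
          {u | OddAt F u (a * p)})ᶜ := by
        ext
        simp only [A, Set.mem_ofPred_eq, Set.mem_iInter, Set.mem_iUnion, Set.mem_preimage,
          exists_prop, Set.mem_compl_iff]
      rw [this]
      exact Finset.measurableSet_biInter _ fun p _ => Finset.measurableSet_biUnion _ fun a _ =>
        ((measurable_patch hφ hU (W * P) v) (isClopen_oddAt F (a * p)).isOpen.measurableSet).compl
    have hex : ∀ m ∈ M', ∃ v, A m v := by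
      intro m hm
      let bad : G → Finset (Finset G) := fun p => (W * P).powerset.filter fun v =>
        ∀ a ∈ I, OddAt F (patch φ U (W * P) v m) (a * p)
      have hbad : ∀ p ∈ P, (bad p).card * 2 ^ K ≤ 2 ^ (W * P).card := by
        intro p hp
        have hch : ∀ a : G, ∃ f ∈ F, f • (a * p) • m ∈ U := fun a => hF _
        choose fa hfa hfaU using hch
        -- One free position is picked in each of `K` disjoint windows; odd parity forces its value
        -- from the other values in the window.
        have hCcard : (I.image fun a => fa a * (a * p)).card = K := by
          rw [Finset.card_image_of_injOn, hIcard]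
          intro a ha a' ha' h
          refine hI a ha a' ha' _ (hfa a) _ (hfa a') ?_
          simpa [← mul_assoc] using h
        have hmem : ∀ f ∈ F, ∀ a ∈ I, f * (a * p) ∈ W * P := fun f hf a ha => by
          rw [← mul_assoc]; exact Finset.mul_mem_mul (hWmem f hf a ha) hp
        have hCsub : (I.image fun a => fa a * (a * p)) ⊆ W * P := by
          intro g hg
          obtain ⟨a, ha, rfl⟩ := Finset.mem_image.1 hg
          exact hmem _ (hfa a) a ha
        have hone : ∀ v ∈ bad p, ∀ v' ∈ bad p,
            v \ (I.image fun a => fa a * (a * p)) = v' \ (I.image fun a => fa a * (a * p)) →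
            ∀ g ∈ I.image (fun a => fa a * (a * p)), g ∈ v → g ∈ v' := by
          intro v hv v' hv' heq g hg hgv
          obtain ⟨a, ha, rfl⟩ := Finset.mem_image.1 hg
          have hUa : (fa a * (a * p)) • m ∈ U := by rw [mul_smul]; exact hfaU a
          by_contra hgv'
          refine (oddAt_flip (u := patch φ U (W * P) v m) (u' := patch φ U (W * P) v' m)
            (a := a * p) (hfa a) (fun f hf hfne => ?_) ?_ ?_).1
            ((Finset.mem_filter.1 hv).2 a ha) ((Finset.mem_filter.1 hv').2 a ha)
          · by_cases hfU : (f * (a * p)) • m ∈ U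
            · rw [Bool.eq_iff_iff, patch_of_mem (hmem f hf a ha) hfU,
                patch_of_mem (hmem f hf a ha) hfU]
              have hnot : f * (a * p) ∉ I.image fun a => fa a * (a * p) := by
                intro hcon
                obtain ⟨a', ha', h⟩ := Finset.mem_image.1 hcon
                have h' : fa a' * a' = f * a := by simpa [← mul_assoc] using h
                have haa := hI a' ha' a ha _ (hfa a') _ hf h'
                subst haa
                exact hfne (mul_right_cancel h').symm
              have := Finset.ext_iff.1 heq (f * (a * p))
              simpa only [Finset.mem_sdiff, hnot, not_false_eq_true, and_true] using this
            · rw [patch_of_not fun _ => hfU, patch_of_not fun _ => hfU]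
          · exact (patch_of_mem (hmem _ (hfa a) a ha) hUa).2 hgv
          · rw [← Bool.not_eq_true, patch_of_mem (hmem _ (hfa a) a ha) hUa]
            exact hgv'
        have := card_mul_two_pow_le hCsub (V := bad p) (Finset.filter_subset _ _)
          (fun v hv v' hv' heq => by
            ext g
            by_cases hg : g ∈ I.image fun a => fa a * (a * p)
            · exact ⟨hone v hv v' hv' heq g hg, hone v' hv' v hv heq.symm g hg⟩
            · have := Finset.ext_iff.1 heq g
              simpa only [Finset.mem_sdiff, hg, not_false_eq_true, and_true] using this)
        rwa [hCcard] at this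
      have hlt : (P.biUnion bad).card < (W * P).powerset.card := by
        rw [Finset.card_powerset]
        refine Nat.lt_of_mul_lt_mul_right (a := 2 ^ K) ?_
        calc (P.biUnion bad).card * 2 ^ K ≤ (∑ p ∈ P, (bad p).card) * 2 ^ K :=
              Nat.mul_le_mul_right _ Finset.card_biUnion_le
          _ = ∑ p ∈ P, (bad p).card * 2 ^ K := Finset.sum_mul _ _ _
          _ ≤ ∑ p ∈ P, 2 ^ (W * P).card := Finset.sum_le_sum hbad
          _ = P.card * 2 ^ (W * P).card := by rw [Finset.sum_const, smul_eq_mul]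
          _ < 2 ^ K * 2 ^ (W * P).card := Nat.mul_lt_mul_of_pos_right hPcard (by positivity)
          _ = 2 ^ (W * P).card * 2 ^ K := mul_comm _ _
      obtain ⟨v, hv, hvn⟩ := Finset.exists_mem_notMem_of_card_lt_card hlt
      refine ⟨v, fun p hp => ?_⟩
      by_contra! hcon
      exact hvn (Finset.mem_biUnion.2 ⟨p, hp, Finset.mem_filter.2 ⟨hv, hcon⟩⟩)
    obtain ⟨φ', hφ', hoff, hon⟩ := exists_measurable_assignment hfree hM' hU hφ (W * P)
      (fun m hm m' hm' w hw w' hw' h => (hblock m hm m' hm' w (Finset.mem_union_left _ hw) w'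
        (Finset.mem_union_left _ hw') h).1) A hA hex
    have hoff' : ∀ y ∉ U, φ' y = φ y := fun y hy => hoff y fun _ _ _ _ _ => hy
    refine ⟨φ', hφ', hoff', fun φ'' hφ'' x => ?_⟩
    rw [hQiff]
    simp only [Bool.false_eq_true, iff_false]
    intro hcon
    obtain ⟨t, ht, htM⟩ := hM'max x trivial
    obtain ⟨p, hp, hodd⟩ := hcon t ht
    obtain ⟨v, hv, hvW⟩ := hon _ htM
    obtain ⟨a, ha, hna⟩ := hv p hp
    refine hna ((oddAt_congr fun f hf => ?_).1 (hodd a ha))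
    have hfap : f * (a * p) ∈ W * P := by
      rw [← mul_assoc]; exact Finset.mul_mem_mul (hWmem f hf a ha) hp
    have e1 : (f * a) • p • t • x = (f * (a * p)) • t • x := by
      simp only [smul_smul, mul_assoc]
    have e2 : (f * (a * p)) • t • x ∉ U' := by
      rw [← mul_assoc]; exact hWPU' _ htM _ (hWmem f hf a ha) p hp
    rw [e1, hφ'' _ e2]
    by_cases hfU : (f * (a * p)) • t • x ∈ U
    · rw [Bool.eq_iff_iff, hvW _ hfap hfU, patch_of_mem hfap hfU]
    · rw [patch_of_not fun _ => hfU, hoff' _ hfU]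
  · -- make all windows at every marker in `M` odd
    let M₁ : Set X := {y | ∃ a ∈ I, a⁻¹ • y ∈ M}
    have hM₁ : MeasurableSet M₁ := by
      have : M₁ = ⋃ a ∈ I, (a⁻¹ • ·) ⁻¹' M := by ext; simp [M₁]
      rw [this]
      exact Finset.measurableSet_biUnion _ fun w _ => (measurable_const_smul _) hM
    let A : X → Finset G → Prop := fun y v => OddAt F (patch φ U F v y) 1
    have hA : ∀ v, MeasurableSet {x | A x v} := fun v =>
      (measurable_patch hφ hU F v) (isClopen_oddAt F 1).isOpen.measurableSet
    have hdisj : ∀ y ∈ M₁, ∀ y' ∈ M₁, ∀ f ∈ F, ∀ f' ∈ F, f • y = f' • y' → y = y' := by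
      rintro y ⟨a, ha, hm⟩ y' ⟨a', ha', hm'⟩ f hf f' hf' h
      have h1 : a'⁻¹ • y' = ((f' * a')⁻¹ * (f * a)) • a⁻¹ • y := by
        have : y' = f'⁻¹ • f • y := by rw [h, inv_smul_smul]
        rw [this]; simp only [smul_smul]; congr 1; group
      rw [h1] at hm'
      have h2 := hMdisc _ hm _ (hEmem _ (hWmem f' hf' a' ha') _ (hWmem f hf a ha)) hm'
      have h3 : f' * a' = f * a := inv_mul_eq_one.1 h2
      have h4 := hI a' ha' a ha f' hf' f hf h3
      subst h4
      have h5 := mul_right_cancel h3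
      subst h5
      exact smul_left_cancel _ h
    have hex : ∀ y ∈ M₁, ∃ v, A y v := by
      intro y _
      obtain ⟨f₀, hf₀, hf₀U⟩ := hF y
      have hflip := oddAt_flip (u := patch φ U F {f₀} y) (u' := patch φ U F ∅ y) (a := 1) hf₀
        (fun f hf hne => by
          by_cases hfU : f • y ∈ U
          · rw [mul_one, Bool.eq_iff_iff, patch_of_mem hf hfU, patch_of_mem hf hfU]
            simp [hne]
          · rw [mul_one, patch_of_not fun _ => hfU, patch_of_not fun _ => hfU])
        (by rw [mul_one, patch_of_mem hf₀ hf₀U]; exact Finset.mem_singleton_self _)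
        (by rw [mul_one, ← Bool.not_eq_true, patch_of_mem hf₀ hf₀U]; exact Finset.notMem_empty _)
      by_cases h : OddAt F (patch φ U F ∅ y) 1
      · exact ⟨∅, h⟩
      · exact ⟨{f₀}, hflip.2 h⟩
    obtain ⟨φ', hφ', hoff, hon⟩ :=
      exists_measurable_assignment hfree hM₁ hU hφ F hdisj A hA hex
    have hoff' : ∀ y ∉ U, φ' y = φ y := fun y hy => hoff y fun _ _ _ _ _ => hy
    refine ⟨φ', hφ', hoff', fun φ'' hφ'' x => ?_⟩
    rw [hQiff]
    simp only [iff_true]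
    intro t ht
    obtain ⟨p, hp, hpM⟩ := hPM (t • x)
    refine ⟨p, hp, fun a ha => ?_⟩
    obtain ⟨v, hv, hvF⟩ := hon (a • p • t • x) ⟨a, ha, by rwa [inv_smul_smul]⟩
    refine (oddAt_congr fun f hf => ?_).1 hv
    have e1 : (f * a) • p • t • x ∉ U' := hMZ hpM _ (hWmem f hf a ha)
    rw [mul_one, hφ'' _ e1, mul_smul]
    by_cases hfU : f • a • p • t • x ∈ U
    · rw [Bool.eq_iff_iff, hvF _ hf hfU, patch_of_mem hf hfU]
    · rw [patch_of_not fun _ => hfU, hoff' _ hfU]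

end Coding

/-! ### The limit construction and the Cantor family -/

section Family

variable {G : Type*} [Group G] [Countable G] [Infinite G] {X : Type*} [MeasurableSpace X]
  [StandardBorelSpace X] [MulAction G X] [MeasurableConstSMul G X]

/-- An aperiodicity step followed by a coding step. -/
lemma exists_aperiodic_coding_step (hfree : ∀ (g : G) (x : X), g • x = x → g = 1)
    {U : Set X} (hU : MeasurableSet U) (hF : ∃ F : Finset G, ∀ x : X, ∃ f ∈ F, f • x ∈ U)
    {g : G} (hg : g ≠ 1) :
    ∃ U' ⊆ U, MeasurableSet U' ∧ (∃ F' : Finset G, ∀ x : X, ∃ f ∈ F', f • x ∈ U') ∧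
      ∃ T : Finset G, ∃ Q : Set (G → Bool), IsClopen Q ∧
        ∀ φ : X → Bool, Measurable φ → ∀ b : Bool, ∃ φ' : X → Bool, Measurable φ' ∧
          (∀ y ∉ U, φ' y = φ y) ∧ ∀ φ'' : X → Bool, (∀ y ∉ U', φ'' y = φ' y) →
            (∀ x, ∃ t ∈ T, φ'' (t • x) ≠ φ'' (t • g • x)) ∧
            ∀ x, ((fun g : G => φ'' (g⁻¹ • x)) ∈ Q ↔ b = true) := by
  classical
  have hins : ∀ {V : Set X}, (∃ F : Finset G, ∀ x : X, ∃ f ∈ F, f • x ∈ V) →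
      ∃ F : Finset G, 1 ∈ F ∧ ∀ x : X, ∃ f ∈ F, f • x ∈ V := by
    rintro V ⟨F, hF⟩
    refine ⟨insert 1 F, Finset.mem_insert_self _ _, fun x => ?_⟩
    obtain ⟨f, hf, h⟩ := hF x
    exact ⟨f, Finset.mem_insert_of_mem hf, h⟩
  obtain ⟨F, hF1, hF⟩ := hins hF
  obtain ⟨U₁, hU₁U, hU₁, hF₁, T, hT⟩ := exists_aperiodic_step hfree hU hF1 hF hg
  obtain ⟨F₁, hF₁1, hF₁⟩ := hins hF₁
  obtain ⟨U₂, hU₂U, hU₂, hF₂, Q, hQ, hcode⟩ := exists_coding_step hfree hU₁ hF₁1 hF₁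
  refine ⟨U₂, hU₂U.trans hU₁U, hU₂, hF₂, T, Q, hQ, fun φ hφ b => ?_⟩
  obtain ⟨φ₁, hφ₁, hoff₁, hgood₁⟩ := hT φ hφ
  obtain ⟨φ₂, hφ₂, hoff₂, hgood₂⟩ := hcode φ₁ hφ₁ b
  refine ⟨φ₂, hφ₂, fun y hy => ?_, fun φ'' hφ'' => ⟨hgood₁ φ'' fun y hy => ?_, hgood₂ φ'' hφ''⟩⟩
  · rw [hoff₂ y fun h => hy (hU₁U h), hoff₁ y hy]
  · rw [hφ'' y fun h => hy (hU₂U h), hoff₂ y hy]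

/-- If every nontrivial translation is detected inside finite windows, uniformly in the orbit,
then the closure of the image of the associated equivariant map is contained in the free part. -/
lemma isMapIntoFree_of_windows {G X : Type*} [Group G] [MeasurableSpace X] [MulAction G X]
    [MeasurableConstSMul G X] {φ : X → Bool} (hφ : Measurable φ)
    (h : ∀ g : G, g ≠ 1 → ∃ T : Finset G, ∀ x : X, ∃ t ∈ T, φ (t • x) ≠ φ (t • g • x)) :
    IsMapIntoFree (fun (x : X) (g : G) => φ (g⁻¹ • x)) where
  measurable := measurable_pi_lambda _ fun g => hφ.comp (measurable_const_smul g⁻¹)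
  equivariant g x := by
    funext a
    simp [shift, mul_smul]
  closure_subset := by
    classical
    intro u hu g hg hgu
    obtain ⟨T, hT⟩ := h g hg
    -- Being `g`-fixed on a finite window is a clopen condition, so a `g`-fixed point of the closure
    -- would yield such a point in the image.
    have hclopen : IsClopen {u : G → Bool | ∀ t ∈ T, u t⁻¹ = u (g⁻¹ * t⁻¹)} :=
      isClopen_of_finite_dep (T.image (fun t => t⁻¹) ∪ T.image fun t => g⁻¹ * t⁻¹) _
        fun u u' huu' => forall₂_congr fun t ht => by
          rw [huu' t⁻¹ (Finset.mem_union_left _ (Finset.mem_image_of_mem _ ht)),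
            huu' (g⁻¹ * t⁻¹) (Finset.mem_union_right _
              (Finset.mem_image_of_mem (fun t => g⁻¹ * t⁻¹) ht))]
    have hmem : u ∈ {u : G → Bool | ∀ t ∈ T, u t⁻¹ = u (g⁻¹ * t⁻¹)} := fun t _ =>
      (congrFun hgu t⁻¹).symm
    obtain ⟨_, hv, x, rfl⟩ := mem_closure_iff.1 hu _ hclopen.isOpen hmem
    obtain ⟨t, ht, hne⟩ := hT x
    apply hne
    have := hv t ht
    simpa [mul_smul] using this

/-- A family of maps into the free part, parametrized by the Cantor space, with pairwise disjoint
closures of images and prescribed values off a syndetic set `U`. -/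
theorem exists_family (hfree : ∀ (g : G) (x : X), g • x = x → g = 1)
    {U : Set X} (hU : MeasurableSet U) (hF : ∃ F : Finset G, ∀ x : X, ∃ f ∈ F, f • x ∈ U)
    {φ : X → Bool} (hφ : Measurable φ) :
    ∃ f : (ℕ → Bool) → X → G → Bool,
      (∀ w, IsMapIntoFree (f w) ∧ ∀ y ∉ U, f w y 1 = φ y) ∧
      (∀ w z, w ≠ z → closure (Set.range (f w)) ∩ closure (Set.range (f z)) = ∅) ∧
      Measurable (fun p : (ℕ → Bool) × X => f p.1 p.2) ∧
      ∀ x, Continuous (fun w => f w x) := by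
  classical
  let S := {V : Set X // MeasurableSet V ∧ ∃ F : Finset G, ∀ x : X, ∃ f ∈ F, f • x ∈ V}
  -- `V'`, `T` and `Q` are chosen before `ψ` and `b`, hence are shared by all parameters `w`.
  have key : ∀ (V : S) (g : {g : G // g ≠ 1}), ∃ V' : S, V'.1 ⊆ V.1 ∧
      ∃ T : Finset G, ∃ Q : Set (G → Bool), IsClopen Q ∧
        ∀ (ψ : {ψ : X → Bool // Measurable ψ}) (b : Bool), ∃ ψ' : {ψ : X → Bool // Measurable ψ},
          (∀ y ∉ V.1, ψ'.1 y = ψ.1 y) ∧ ∀ ψ'' : X → Bool, (∀ y ∉ V'.1, ψ'' y = ψ'.1 y) →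
            (∀ x, ∃ t ∈ T, ψ'' (t • x) ≠ ψ'' (t • g.1 • x)) ∧
            ∀ x, ((fun g : G => ψ'' (g⁻¹ • x)) ∈ Q ↔ b = true) := by
    intro V g
    obtain ⟨V', hV'V, hV', hF', T, Q, hQ, h⟩ :=
      exists_aperiodic_coding_step hfree V.2.1 V.2.2 g.2
    refine ⟨⟨V', hV', hF'⟩, hV'V, T, Q, hQ, fun ψ b => ?_⟩
    obtain ⟨ψ', hψ', h1, h2⟩ := h ψ.1 ψ.2 b
    exact ⟨⟨ψ', hψ'⟩, h1, h2⟩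
  choose next hnext T Q hQ step hoff hgood using key
  have : Nonempty {g : G // g ≠ 1} := by
    obtain ⟨g, hg⟩ := exists_ne (1 : G)
    exact ⟨⟨g, hg⟩⟩
  obtain ⟨e, he⟩ := exists_surjective_nat {g : G // g ≠ 1}
  obtain ⟨V, hV0, hVs⟩ : ∃ V : ℕ → S, V 0 = ⟨U, hU, hF⟩ ∧ ∀ n, V (n + 1) = next (V n) (e n) :=
    ⟨fun n => Nat.rec ⟨U, hU, hF⟩ (fun n V => next V (e n)) n, rfl, fun _ => rfl⟩
  obtain ⟨Φ, hΦ0, hΦs⟩ : ∃ Φ : (ℕ → Bool) → ℕ → {ψ : X → Bool // Measurable ψ},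
      (∀ w, Φ w 0 = ⟨φ, hφ⟩) ∧ ∀ w n, Φ w (n + 1) = step (V n) (e n) (Φ w n) (w n) :=
    ⟨fun w n => Nat.rec ⟨φ, hφ⟩ (fun n ψ => step (V n) (e n) ψ (w n)) n, fun _ => rfl,
      fun _ _ => rfl⟩
  have hVanti : Antitone fun n => (V n).1 := antitone_nat_of_succ_le fun n => by
    rw [hVs]; exact hnext _ _
  have hΦconst : ∀ w m n, m ≤ n → ∀ y ∉ (V m).1, (Φ w n).1 y = (Φ w m).1 y := by
    intro w m n hmn y hy
    induction n, hmn using Nat.le_induction with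
    | base => rfl
    | succ n hn ih => rw [hΦs, hoff _ _ _ _ y fun h => hy (hVanti hn h), ih]
  have hΦdep : ∀ n w w', (∀ i < n, w i = w' i) → Φ w n = Φ w' n := by
    intro n
    induction n with
    | zero => intro w w' _; rw [hΦ0, hΦ0]
    | succ n ih =>
      intro w w' h
      rw [hΦs, hΦs, ih w w' fun i hi => h i (by omega), h n (by omega)]
  -- A position outside `V n` has its final value from stage `n` on, depending only on the first `n`
  -- bits of `w`. Positions in every `V n` get `false` for all `w`, which preserves continuity.
  let ψ : (ℕ → Bool) → X → Bool := fun w y =>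
    if h : ∃ n, y ∉ (V n).1 then (Φ w (Nat.find h)).1 y else false
  have hψ : ∀ w n, ∀ y ∉ (V n).1, ψ w y = (Φ w n).1 y := by
    intro w n y hy
    have h : ∃ n, y ∉ (V n).1 := ⟨n, hy⟩
    simp only [ψ]
    rw [dif_pos h]
    exact (hΦconst w _ n (Nat.find_min' h hy) y (Nat.find_spec h)).symm
  have hψmeas : ∀ w, Measurable (ψ w) := by
    intro w
    refine measurable_to_bool ?_
    have : ψ w ⁻¹' {true} = ⋃ n, ((V n).1ᶜ ∩ (Φ w n).1 ⁻¹' {true}) := by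
      ext y
      simp only [Set.mem_preimage, Set.mem_singleton_iff, Set.mem_iUnion, Set.mem_inter_iff,
        Set.mem_compl_iff]
      constructor
      · intro hy
        by_cases h : ∃ n, y ∉ (V n).1
        · obtain ⟨n, hn⟩ := h
          exact ⟨n, hn, by rw [← hψ w n y hn, hy]⟩
        · simp [ψ, h] at hy
      · rintro ⟨n, hn, h⟩
        rw [hψ w n y hn, h]
    rw [this]
    exact MeasurableSet.iUnion fun n =>
      (V n).2.1.compl.inter ((Φ w n).2 (measurableSet_singleton true))
  have hψgood : ∀ w n, (∀ x, ∃ t ∈ T (V n) (e n), ψ w (t • x) ≠ ψ w (t • (e n).1 • x)) ∧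
      ∀ x, ((fun g : G => ψ w (g⁻¹ • x)) ∈ Q (V n) (e n) ↔ w n = true) := by
    intro w n
    refine hgood (V n) (e n) (Φ w n) (w n) (ψ w) fun y hy => ?_
    rw [← hVs] at hy
    rw [hψ w (n + 1) y hy, hΦs]
  have hcont : ∀ x : X, Continuous fun (w : ℕ → Bool) (g : G) => ψ w (g⁻¹ • x) := by
    intro x
    refine continuous_pi fun g => ?_
    set y := g⁻¹ • x
    by_cases h : ∃ n, y ∉ (V n).1
    · obtain ⟨n, hn⟩ := h
      refine (continuous_bool_rng true).2 ?_
      refine isClopen_of_finite_dep (Finset.range n) _ fun w w' hww' => ?_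
      simp only [Set.mem_preimage, Set.mem_singleton_iff]
      rw [hψ w n y hn, hψ w' n y hn, hΦdep n w w' fun i hi => hww' i (Finset.mem_range.2 hi)]
    · have : (fun w : ℕ → Bool => ψ w y) = fun _ => false := by
        funext w; simp only [ψ]; rw [dif_neg h]
      rw [this]
      exact continuous_const
  have hmap : ∀ w, IsMapIntoFree (fun (x : X) (g : G) => ψ w (g⁻¹ • x)) := fun w =>
    isMapIntoFree_of_windows (hψmeas w) fun g hg => by
      obtain ⟨n, hn⟩ := he ⟨g, hg⟩
      refine ⟨T (V n) (e n), fun x => ?_⟩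
      have := (hψgood w n).1 x
      rwa [hn] at this ⊢
  refine ⟨fun w x g => ψ w (g⁻¹ • x), fun w => ⟨hmap w, fun y hy => ?_⟩, ?_, ?_, hcont⟩
  · have h0 : y ∉ (V 0).1 := by rw [hV0]; exact hy
    simp only [inv_one, one_smul]
    rw [hψ w 0 y h0, hΦ0]
  · have hclosure : ∀ w n, closure (Set.range fun (x : X) (g : G) => ψ w (g⁻¹ • x)) ⊆
        {u | u ∈ Q (V n) (e n) ↔ w n = true} := by
      intro w n
      refine closure_minimal ?_ ?_
      · rintro _ ⟨x, rfl⟩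
        exact (hψgood w n).2 x
      · cases hw : w n
        · simp only [Bool.false_eq_true, iff_false]
          exact (hQ (V n) (e n)).compl.isClosed
        · simp only [iff_true]
          exact (hQ (V n) (e n)).isClosed
    intro w z hwz
    obtain ⟨n, hn⟩ := Function.ne_iff.1 hwz
    refine Set.eq_empty_of_forall_notMem fun u hu => hn ?_
    have h1 := hclosure w n hu.1
    have h2 := hclosure z n hu.2
    rw [Bool.eq_iff_iff]
    exact h1.symm.trans h2
  · exact measurable_uncurry_of_continuous_of_measurable
      (u := fun (w : ℕ → Bool) (x : X) (g : G) => ψ w (g⁻¹ • x)) hcont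
      fun w => (hmap w).measurable

end Family

/-! ### Density and the `G_δ` property in the measure algebra -/

section MeasureAlgebra

open scoped symmDiff ENNReal Topology

/-- The set of points whose `A`-pattern on the window `T` is fixed by `g`. -/
def windowFixed {G X : Type*} [Group G] [MulAction G X] (g : G) (T : Set G) (A : Set X) : Set X :=
  {x | ∀ h ∈ T, h • g • x ∈ A ↔ h • x ∈ A}

lemma setMap_eq_true {G X : Type*} [Group G] [MulAction G X] {A : Set X} {x : X} {h : G} :
    setMap G A x h = true ↔ h⁻¹ • x ∈ A := by
  simp [setMap, Set.mem_smul_set_iff_inv_smul_mem]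

lemma setMap_mem_freePart {G X : Type*} [Group G] [MulAction G X] {A : Set X} {x : X} :
    setMap G A x ∈ freePart G ↔ ∀ g : G, g ≠ 1 → x ∉ windowFixed g Set.univ A := by
  refine forall₂_congr fun g _ => not_congr ?_
  rw [funext_iff]
  constructor
  · intro h a _
    have := h a⁻¹
    rw [Bool.eq_iff_iff, shift, setMap_eq_true, setMap_eq_true] at this
    simpa [mul_smul] using this
  · intro h a
    rw [Bool.eq_iff_iff, shift, setMap_eq_true, setMap_eq_true]
    simpa [mul_smul] using h a⁻¹ trivial

/-- An equivariant map is `setMap` of the set of points where its value at `1` is `true`. -/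
lemma Equivariant.setMap_eq {G X : Type*} [Group G] [MulAction G X] {f : X → G → Bool}
    (hf : Equivariant f) : setMap G {x | f x 1 = true} = f := by
  funext x h
  rw [Bool.eq_iff_iff, setMap_eq_true, Set.mem_ofPred_eq, hf]
  simp [shift]

lemma IsMapIntoFree.range_setMap_subset {G X : Type*} [Group G] [MulAction G X]
    [MeasurableSpace X] {f : X → G → Bool} (hf : IsMapIntoFree f) :
    Set.range (setMap G {x | f x 1 = true}) ⊆ freePart G := by
  rw [hf.equivariant.setMap_eq]
  exact subset_closure.trans hf.closure_subset

lemma IsMapIntoFree.measurableSet {G X : Type*} [Group G] [MulAction G X]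
    [MeasurableSpace X] {f : X → G → Bool} (hf : IsMapIntoFree f) :
    MeasurableSet {x | f x 1 = true} :=
  ((measurable_pi_apply 1).comp hf.measurable) (measurableSet_singleton true)

variable {G : Type*} [Group G] [Countable G] {X : Type*} [MeasurableSpace X]
  [MulAction G X] [MeasurableConstSMul G X]

lemma measurableSet_windowFixed (g : G) (T : Set G) {A : Set X} (hA : MeasurableSet A) :
    MeasurableSet (windowFixed g T A) := by
  have : windowFixed g T A = ⋂ h ∈ T, {x | h • g • x ∈ A ↔ h • x ∈ A} := by
    ext; simp [windowFixed]
  rw [this]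
  refine MeasurableSet.biInter T.to_countable fun h _ => ?_
  exact MeasurableSet.iff (((measurable_const_smul h).comp (measurable_const_smul g)) hA)
    ((measurable_const_smul h) hA)

/-- Translations are continuous on the measure algebra of a quasi-invariant measure. -/
lemma IsQuasiInvariant.tendsto_measure_preimage_symmDiff {G X : Type*} [Group G]
    [MeasurableSpace X] [MulAction G X] [MeasurableConstSMul G X] {μ : Measure X} [IsFiniteMeasure μ]
    (hμ : IsQuasiInvariant G μ) (g : G) (A : MeasuredSets μ) :
    Filter.Tendsto (fun B : MeasuredSets μ => μ ((g • ·) ⁻¹' ((B : Set X) ∆ A))) (𝓝 A) (𝓝 0) := by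
  rw [ENNReal.tendsto_nhds_zero]
  intro ε hε
  have hac : μ.map (g • ·) ≪ μ := (hμ g).absolutelyContinuous
  -- The translated measure has an integrable density, so absolute continuity of the integral makes
  -- it small on `μ`-small sets.
  have hfin : ∫⁻ x, (μ.map (g • ·)).rnDeriv μ x ∂μ ≠ ∞ := (Measure.lintegral_rnDeriv_lt_top _ _).ne
  obtain ⟨δ, hδ, h⟩ := exists_pos_setLIntegral_lt_of_measure_lt hfin hε.ne'
  filter_upwards [Metric.eball_mem_nhds A hδ] with B hB
  have hBA : μ ((B : Set X) ∆ A) < δ := hB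
  have := h _ hBA
  rw [Measure.setLIntegral_rnDeriv hac] at this
  exact ((Measure.map_apply (measurable_const_smul g) (B.2.symmDiff A.2)).symm.trans_lt this).le

/-- Replacing `A` by `B` enlarges the fixed set by at most finitely many translates of `B ∆ A`, each
of small measure; finiteness of `T` is essential. -/
lemma IsQuasiInvariant.isOpen_windowFixed_lt {G X : Type*} [Group G]
    [MeasurableSpace X] [MulAction G X] [MeasurableConstSMul G X] {μ : Measure X} [IsFiniteMeasure μ]
    (hμ : IsQuasiInvariant G μ) (g : G) (T : Finset G) (c : ℝ≥0∞) :
    IsOpen {A : MeasuredSets μ | μ (windowFixed g T (A : Set X)) < c} := by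
  rw [isOpen_iff_eventually]
  intro A hA
  have h1 : Filter.Tendsto (fun B : MeasuredSets μ => μ (windowFixed g T (A : Set X)) +
      ∑ h ∈ T, (μ (((h * g) • ·) ⁻¹' ((B : Set X) ∆ A)) + μ ((h • ·) ⁻¹' ((B : Set X) ∆ A))))
      (𝓝 A) (𝓝 (μ (windowFixed g T (A : Set X)) + ∑ h ∈ T, (0 + 0))) :=
    tendsto_const_nhds.add (tendsto_finsetSum _ fun h _ =>
      (hμ.tendsto_measure_preimage_symmDiff (h * g) A).add
        (hμ.tendsto_measure_preimage_symmDiff h A))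
  simp only [add_zero, Finset.sum_const_zero] at h1
  filter_upwards [h1.eventually_lt_const hA] with B hB
  refine lt_of_le_of_lt ?_ hB
  have hsub : windowFixed g T (B : Set X) ⊆ windowFixed g T (A : Set X) ∪
      ⋃ h ∈ T, (((h * g) • ·) ⁻¹' ((B : Set X) ∆ A) ∪ (h • ·) ⁻¹' ((B : Set X) ∆ A)) := by
    intro x hx
    by_contra hcon
    simp only [Set.mem_union, Set.mem_iUnion, Set.mem_preimage, not_or, not_exists,
      Set.mem_symmDiff, mul_smul] at hcon
    apply hcon.1
    intro h hh
    have h1 := hx h hh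
    have h2 := hcon.2 h hh
    tauto
  refine (measure_mono hsub).trans ((measure_union_le _ _).trans ?_)
  gcongr
  refine (measure_biUnion_finset_le _ _).trans ?_
  gcongr
  exact measure_union_le _ _

/-- Continuity from above along finite windows exhausting `G`. It turns a null condition into a
countable intersection of unions of open conditions. -/
lemma measure_windowFixed_univ_eq_zero_iff {μ : Measure X} [IsFiniteMeasure μ] (g : G) {A : Set X}
    (hA : MeasurableSet A) :
    μ (windowFixed g Set.univ A) = 0 ↔
      ∀ k : ℕ, ∃ T : Finset G, μ (windowFixed g T A) < ((k : ℝ≥0∞) + 1)⁻¹ := by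
  classical
  constructor
  · intro h0 k
    obtain ⟨e, he⟩ := exists_surjective_nat G
    have hanti : Antitone fun n => windowFixed g ((Finset.range n).image e : Finset G) A := by
      intro m n hmn x hx a ha
      refine hx a ?_
      exact Finset.mem_coe.2 (Finset.image_subset_image (Finset.range_mono hmn) ha)
    have hinter : ⋂ n, windowFixed g ((Finset.range n).image e : Finset G) A =
        windowFixed g Set.univ A := by
      ext x
      rw [Set.mem_iInter]
      constructor
      · intro hx a _
        obtain ⟨n, rfl⟩ := he a
        exact hx (n + 1) _ (Finset.mem_coe.2 (Finset.mem_image_of_mem _ (by simp)))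
      · exact fun hx n a _ => hx a trivial
    have ht := tendsto_measure_iInter_atTop (μ := μ)
      (fun n => (measurableSet_windowFixed g ((Finset.range n).image e : Finset G) hA
        ).nullMeasurableSet) hanti ⟨0, measure_ne_top _ _⟩
    rw [hinter, h0] at ht
    have hpos : (0 : ℝ≥0∞) < ((k : ℝ≥0∞) + 1)⁻¹ := by
      rw [ENNReal.inv_pos]
      exact ENNReal.add_ne_top.2 ⟨ENNReal.natCast_ne_top k, ENNReal.one_ne_top⟩
    obtain ⟨n, hn⟩ := (ht.eventually_lt_const hpos).exists
    exact ⟨_, hn⟩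
  · intro h
    by_contra hne
    obtain ⟨k, hk⟩ := ENNReal.exists_inv_nat_lt hne
    obtain ⟨T, hT⟩ := h k
    have h1 : μ (windowFixed g Set.univ A) ≤ μ (windowFixed g T A) :=
      measure_mono fun x hx a _ => hx a trivial
    have h2 : ((k : ℝ≥0∞) + 1)⁻¹ ≤ (k : ℝ≥0∞)⁻¹ := ENNReal.inv_le_inv.2 le_self_add
    exact absurd (h1.trans_lt (hT.trans_le h2)) hk.not_gt

/-- The open conditions only give freeness almost everywhere. The exceptional set is null and
invariant, so on it `A` may be replaced by the set coming from `f₀` without changing the class. -/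
lemma isGδ_freeClasses {μ : Measure X} [IsFiniteMeasure μ] (hμ : IsQuasiInvariant G μ)
    {f₀ : X → G → Bool} (hf₀ : IsMapIntoFree f₀) : IsGδ (freeClasses G μ) := by
  let O : G → ℕ → Set (MeasuredSets μ) := fun g k =>
    {A | ∃ T : Finset G, μ (windowFixed g T (A : Set X)) < ((k : ℝ≥0∞) + 1)⁻¹}
  have hO : ∀ g k, IsOpen (O g k) := by
    intro g k
    have : O g k = ⋃ T : Finset G,
        {A : MeasuredSets μ | μ (windowFixed g T (A : Set X)) < ((k : ℝ≥0∞) + 1)⁻¹} := by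
      ext; simp [O]
    rw [this]
    exact isOpen_iUnion fun T => hμ.isOpen_windowFixed_lt g T _
  have heq : freeClasses G μ = ⋂ (g : {g : G // g ≠ 1}), ⋂ k, SeparationQuotient.mk '' O g k := by
    ext a
    simp only [Set.mem_iInter]
    constructor
    · rintro ⟨A, hA, hfree, rfl⟩ ⟨g, hg⟩ k
      refine ⟨measuredSet μ A hA, ?_, rfl⟩
      refine (measure_windowFixed_univ_eq_zero_iff g hA).1 ?_ k
      have : windowFixed g Set.univ A = ∅ := Set.eq_empty_of_forall_notMem fun x =>
        setMap_mem_freePart.1 (hfree ⟨x, rfl⟩) g hg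
      rw [this, measure_empty]
    · intro ha
      obtain ⟨⟨A, hA⟩, rfl⟩ := SeparationQuotient.surjective_mk a
      have hnull : ∀ g : G, g ≠ 1 → μ (windowFixed g Set.univ A) = 0 := by
        intro g hg
        refine (measure_windowFixed_univ_eq_zero_iff g hA).2 fun k => ?_
        have h1 : (⟨A, hA⟩ : MeasuredSets μ) ∈
            SeparationQuotient.mk ⁻¹' (SeparationQuotient.mk '' O g k) := ha ⟨g, hg⟩ k
        rw [SeparationQuotient.preimage_image_mk_open (hO g k)] at h1
        exact h1
      let N : Set X := ⋃ g : {g : G // g ≠ 1}, windowFixed g.1 Set.univ A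
      have hN : MeasurableSet N := MeasurableSet.iUnion fun g => measurableSet_windowFixed _ _ hA
      have hN0 : μ N = 0 := measure_iUnion_null fun g => hnull g.1 g.2
      have hNmem : ∀ x, x ∉ N ↔ setMap G A x ∈ freePart G := by
        intro x
        rw [setMap_mem_freePart]
        simp [N]
      -- A period `g` at `x` becomes the conjugate period `h * g * h⁻¹` at `h • x`.
      have hNinv : ∀ (h : G) (x : X), x ∈ N → h • x ∈ N := by
        intro h x hx
        obtain ⟨⟨g, hg⟩, hgx⟩ := Set.mem_iUnion.1 hx
        refine Set.mem_iUnion.2 ⟨⟨h * g * h⁻¹, fun hc => hg (conj_eq_one_iff.1 hc)⟩, fun a _ => ?_⟩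
        have := hgx (a * h) trivial
        simpa [mul_smul] using this
      have hNinv' : ∀ (h : G) (x : X), h • x ∈ N ↔ x ∈ N := fun h x =>
        ⟨fun hx => by simpa using hNinv h⁻¹ _ hx, hNinv h x⟩
      let A₀ : Set X := {x | f₀ x 1 = true}
      refine ⟨A \ N ∪ A₀ ∩ N, (hA.diff hN).union (hf₀.measurableSet.inter hN), ?_, ?_⟩
      · rintro _ ⟨x, rfl⟩
        by_cases hx : x ∈ N
        · have : setMap G (A \ N ∪ A₀ ∩ N) x = setMap G A₀ x := by
            funext h
            rw [Bool.eq_iff_iff, setMap_eq_true, setMap_eq_true]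
            have := (hNinv' h⁻¹ x).2 hx
            simp [this]
          rw [this]
          exact hf₀.range_setMap_subset ⟨x, rfl⟩
        · have : setMap G (A \ N ∪ A₀ ∩ N) x = setMap G A x := by
            funext h
            rw [Bool.eq_iff_iff, setMap_eq_true, setMap_eq_true]
            have : h⁻¹ • x ∉ N := fun h' => hx ((hNinv' h⁻¹ x).1 h')
            simp [this]
          rw [this]
          exact (hNmem x).1 hx
      · refine SeparationQuotient.mk_eq_mk.2 (EMetric.inseparable_iff.2 ?_)
        refine measure_mono_null (fun x hx => ?_) hN0
        by_contra hxN
        rcases hx with ⟨h1, h2⟩ | ⟨h1, h2⟩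
        · exact h2 (Or.inl ⟨h1, hxN⟩)
        · rcases h1 with h1 | h1
          · exact h2 h1.1
          · exact hxN h1.2
  rw [heq]
  exact IsGδ.iInter fun g => IsGδ.iInter fun k =>
    (SeparationQuotient.isOpenMap_mk _ (hO g k)).isGδ

variable [Infinite G] [StandardBorelSpace X]

/-- There are syndetic Borel sets of arbitrarily small measure. -/
lemma exists_syndetic_measure_lt {G X : Type*} [Group G] [Infinite G] [MeasurableSpace X]
    [StandardBorelSpace X] [MulAction G X] [MeasurableConstSMul G X]
    (hfree : ∀ (g : G) (x : X), g • x = x → g = 1) (μ : Measure X)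
    [IsProbabilityMeasure μ] {ε : ℝ≥0∞} (hε : 0 < ε) :
    ∃ U : Set X, MeasurableSet U ∧ (∃ F : Finset G, ∀ x : X, ∃ f ∈ F, f • x ∈ U) ∧ μ U < ε := by
  classical
  obtain ⟨n, hn⟩ := ENNReal.exists_nat_mul_gt hε.ne' ENNReal.one_ne_top
  obtain ⟨I, hI⟩ := Infinite.exists_subset_card_eq G n
  have hIne : I.Nonempty := by
    rw [← Finset.card_pos, hI, Nat.pos_iff_ne_zero]
    rintro rfl
    simp at hn
  obtain ⟨i, hi⟩ := hIne
  have h1 : (1 : G) ∈ I⁻¹ * I := by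
    simpa using Finset.mul_mem_mul (Finset.inv_mem_inv hi) hi
  have hinv : ∀ d ∈ I⁻¹ * I, d⁻¹ ∈ I⁻¹ * I := by
    intro d hd
    have h2 : (I⁻¹ * I)⁻¹ = I⁻¹ * I := by rw [mul_inv_rev, inv_inv]
    rw [← h2]
    exact Finset.inv_mem_inv hd
  obtain ⟨M, -, hM, hdisc, hmax⟩ :=
    exists_maximal_discrete hfree _ h1 hinv (MeasurableSet.univ (α := X))
  have hmeas : ∀ d : G, MeasurableSet ((d⁻¹ • ·) ⁻¹' M) := fun d => (measurable_const_smul d⁻¹) hM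
  have hdisj : (I : Set G).PairwiseDisjoint fun d => (d⁻¹ • ·) ⁻¹' M := by
    intro d hd d' hd' hne
    refine Set.disjoint_left.2 fun x hx hx' => hne ?_
    have e1 : d'⁻¹ • x = (d'⁻¹ * d) • d⁻¹ • x := by simp [mul_smul]
    have e2 : (d'⁻¹ * d) • d⁻¹ • x ∈ M := e1 ▸ hx'
    exact (inv_mul_eq_one.1 (hdisc _ hx _ (Finset.mul_mem_mul (Finset.inv_mem_inv hd') hd) e2)).symm
  -- `n` disjoint translates of `M` in a probability space with `n * ε > 1` cannot all have measure
  -- at least `ε`; every translate of `M` is again syndetic.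
  obtain ⟨d, hd, hlt⟩ : ∃ d ∈ I, μ ((d⁻¹ • ·) ⁻¹' M) < ε := by
    by_contra! hcon
    have h3 : (n : ℝ≥0∞) * ε ≤ 1 := by
      calc (n : ℝ≥0∞) * ε = ∑ d ∈ I, ε := by rw [Finset.sum_const, hI, nsmul_eq_mul]
        _ ≤ ∑ d ∈ I, μ ((d⁻¹ • ·) ⁻¹' M) := Finset.sum_le_sum hcon
        _ = μ (⋃ d ∈ I, (d⁻¹ • ·) ⁻¹' M) :=
          (measure_biUnion_finset hdisj fun d _ => hmeas d).symm
        _ ≤ 1 := prob_le_one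
    exact absurd hn h3.not_gt
  refine ⟨_, hmeas d, ⟨{d} * (I⁻¹ * I), fun x => ?_⟩, hlt⟩
  obtain ⟨e, he, hex⟩ := hmax x trivial
  refine ⟨d * e, Finset.mul_mem_mul (Finset.mem_singleton_self d) he, ?_⟩
  simpa [mul_smul] using hex

/-- Prescribing the indicator of `A` off a syndetic `U` of measure less than `ε`, `exists_family`
yields a free class whose representative differs from `A` only inside `U`. -/
lemma dense_freeClasses (hfree : ∀ (g : G) (x : X), g • x = x → g = 1) (μ : Measure X)
    [IsProbabilityMeasure μ] : Dense (freeClasses G μ) := by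
  classical
  have hdense : Dense {A : MeasuredSets μ | Set.range (setMap G (A : Set X)) ⊆ freePart G} := by
    intro A
    rw [EMetric.mem_closure_iff]
    intro ε hε
    obtain ⟨U, hU, hF, hlt⟩ := exists_syndetic_measure_lt (G := G) hfree μ hε
    have hA : Measurable fun x => decide (x ∈ (A : Set X)) := by
      refine measurable_to_bool ?_
      convert (show MeasurableSet (A : Set X) from A.2) using 1
      ext
      simp only [Set.mem_preimage, Set.mem_singleton_iff, decide_eq_true_eq]
    obtain ⟨f, hf, -⟩ := exists_family hfree hU hF hA
    obtain ⟨hfw, hfU⟩ := hf fun _ => false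
    refine ⟨measuredSet μ _ hfw.measurableSet, hfw.range_setMap_subset, ?_⟩
    refine lt_of_le_of_lt (measure_mono fun x hx => ?_) hlt
    by_contra hxU
    have hx1 := hfU x hxU
    have hiff : x ∈ {x | f (fun _ => false) x 1 = true} ↔ x ∈ (A : Set X) := by
      rw [Set.mem_ofPred_eq, hx1, decide_eq_true_eq]
    rcases hx with ⟨h1, h2⟩ | ⟨h1, h2⟩
    · exact h2 (hiff.2 h1)
    · exact h2 (hiff.1 h1)
  refine (SeparationQuotient.surjective_mk.denseRange.dense_image
    SeparationQuotient.continuous_mk hdense).mono ?_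
  rintro _ ⟨A, hA, rfl⟩
  exact ⟨A, A.2, hA, rfl⟩

end MeasureAlgebra

lemma IsSyndetic.exists_finset_smul_mem {G X : Type*} [Group G] [MulAction G X] {M : Set X}
    (hM : IsSyndetic G M) : ∃ F : Finset G, ∀ x : X, ∃ f ∈ F, f • x ∈ M := by
  classical
  obtain ⟨F, hF⟩ := hM
  refine ⟨F⁻¹, fun x => ?_⟩
  obtain ⟨f, hf, m, hm, rfl⟩ := Set.mem_smul.1 (hF ▸ Set.mem_univ x)
  exact ⟨f⁻¹, Finset.inv_mem_inv hf, by simpa using hm⟩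

end TwoShift

theorem theorem1p1 {G : Type*} [Group G] [Countable G] [Infinite G]
    {X : Type*} [MeasurableSpace X] [StandardBorelSpace X]
    [MulAction G X] [MeasurableConstSMul G X]
    (hfree : ∀ (g : G) (x : X), g • x = x → g = 1) :
    (∃ f : X → G → Bool, TwoShift.IsMapIntoFree f) ∧
    (∀ Y : Set X, MeasurableSet Y → TwoShift.IsSyndetic G Yᶜ →
      ∀ φ : Y → Bool, Measurable φ →
        ∃ f : X → G → Bool, TwoShift.IsMapIntoFree f ∧ ∀ y : Y, f y 1 = φ y) ∧
    (∀ Y : Set X, MeasurableSet Y → TwoShift.IsSyndetic G Yᶜ →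
      ∀ φ : Y → Bool, Measurable φ →
        ∃ f : (ℕ → Bool) → X → G → Bool,
          (∀ w, TwoShift.IsMapIntoFree (f w) ∧ ∀ y : Y, f w y 1 = φ y) ∧
          (∀ w z, w ≠ z →
            closure (Set.range (f w)) ∩ closure (Set.range (f z)) = ∅) ∧
          Measurable (fun p : (ℕ → Bool) × X => f p.1 p.2) ∧
          ∀ x, Continuous (fun w => f w x)) ∧
    (∀ μ : MeasureTheory.Measure X, MeasureTheory.IsProbabilityMeasure μ →
      TwoShift.IsQuasiInvariant G μ →
        Dense (TwoShift.freeClasses G μ) ∧ IsGδ (TwoShift.freeClasses G μ)) := by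
  classical
  have family : ∀ Y : Set X, MeasurableSet Y → TwoShift.IsSyndetic G Yᶜ →
      ∀ φ : Y → Bool, Measurable φ →
        ∃ f : (ℕ → Bool) → X → G → Bool,
          (∀ w, TwoShift.IsMapIntoFree (f w) ∧ ∀ y : Y, f w y 1 = φ y) ∧
          (∀ w z, w ≠ z →
            closure (Set.range (f w)) ∩ closure (Set.range (f z)) = ∅) ∧
          Measurable (fun p : (ℕ → Bool) × X => f p.1 p.2) ∧
          ∀ x, Continuous (fun w => f w x) := by
    intro Y hY hsynd φ hφ
    -- `φ` is extended by `false` off `Y`; those values are free to change.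
    obtain ⟨f, hf, h⟩ := TwoShift.exists_family hfree hY.compl hsynd.exists_finset_smul_mem
      (Measurable.dite (s := Y) hφ (measurable_const (a := false)) hY)
    refine ⟨f, fun w => ⟨(hf w).1, fun y => ?_⟩, h⟩
    rw [(hf w).2 y fun hy => hy y.2, dif_pos y.2]
  have extension : ∀ Y : Set X, MeasurableSet Y → TwoShift.IsSyndetic G Yᶜ →
      ∀ φ : Y → Bool, Measurable φ →
        ∃ f : X → G → Bool, TwoShift.IsMapIntoFree f ∧ ∀ y : Y, f y 1 = φ y := by
    intro Y hY hsynd φ hφ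
    obtain ⟨f, hf, -⟩ := family Y hY hsynd φ hφ
    exact ⟨f fun _ => false, hf _⟩
  have base : ∃ f : X → G → Bool, TwoShift.IsMapIntoFree f := by
    obtain ⟨f, hf, -⟩ := extension ∅ MeasurableSet.empty ⟨{1}, by simp⟩ (fun _ => false)
      measurable_const
    exact ⟨f, hf⟩
  refine ⟨base, extension, family, fun μ hμ hq => ⟨TwoShift.dense_freeClasses hfree μ, ?_⟩⟩
  obtain ⟨f₀, hf₀⟩ := base
  exact TwoShift.isGδ_freeClasses hq hf₀
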